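/- Throughout, $G$ is a finite abelian group, written additively, and $C_m$ is the cyclic group of order $m$. A (squarefree) \emph{indexed sequence} over $G$ is a finite family of distinct labelled nonzero elements of $G$, i.e. a finite subset of $(G\setminus\{0\})\times\mathbb{N}$, so that an element of $G$ may be repeated with different labels. It is \emph{zero-sum} if the sum of its terms (labels forgotten) is $0$, and \emph{irreducible} if it is nonempty, zero-sum, and has no nonempty proper zero-sum subsequence. A \emph{unique factorization indexed sequence} (UFIS) is a zero-sum indexed sequence that can be written in exactly one way, up to the order of the factors, as a product (disjoint union) of irreducible indexed sequences. The \emph{cross number} of an indexed sequence $S$ is $\mathsf{k}(S)=\sum_{(g,j)\in S}\frac{1}{\operatorname{ord}(g)}$, and $$\mathsf{K}_1(G)=\max\{\mathsf{k}(S): S\text{ is a UFIS over }G\}.$$ If $G\cong\bigoplus_{i=1}^{r}C_{p_i^{\alpha_i}}$ with $p_i$ prime (not necessarily distinct) and $\alpha_i\ge 1$, put $$\mathsf{K}_1^*(G)=\sum_{i=1}^{r}\frac{p_i^{\alpha_i}-1}{p_i^{\alpha_i}-p_i^{\alpha_i-1}}.$$ A prime $p$ is \emph{$2$-wide with respect to}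 a positive integer $m=q_1^{\alpha_1}\cdots q_r^{\alpha_r}$ ($q_j$ distinct primes, $\alpha_j\geq 1$) if $p\nmid m$ and $$\frac{p^2+2p-2}{p^2}\ \geq\ \prod_{j=1}^{r}\frac{q_j^{\alpha_j+1}-1}{q_j^{\alpha_j+1}-q_j^{\alpha_j}}.$$ A positive integer $n=q_1^{\alpha_1}\cdots q_r^{\alpha_r}$ with primes $q_1<\cdots<q_r$ and $\alpha_j\geq 1$ is \emph{$2$-wide} if for each $i$ with $1\le i\le r-1$ the prime $q_i$ is $2$-wide with respect to $\prod_{j=i+1}^{r}q_j^{\alpha_j}$. \textbf{Corollary.} Let $n$ be a $2$-wide positive integer, and let $q$ be its largest or second largest (distinct) prime factor. Then $\mathsf{K}_1(C_n)=\mathsf{K}_1^*(C_n)$ and $\mathsf{K}_1(C_n\oplus C_q)=\mathsf{K}_1^*(C_n\oplus C_q)$. -/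

import Mathlib

open scoped DirectSum

/-! ### Indexed sequences over a finite abelian group -/

/-- An indexed sequence over `G`: an element of the free abelian monoid on
`(G \ {0}) × ℕ`, written as a finite multiset. -/
abbrev IndexedSeq (G : Type*) [AddCommGroup G] : Type _ :=
  Multiset ({g : G // g ≠ 0} × ℕ)

namespace IndexedSeq

variable {G : Type*} [AddCommGroup G]

/-- The sum of an indexed sequence, an element of `G`. -/
def sigma (S : IndexedSeq G) : G :=
  (S.map fun x => (x.1 : G)).sum

/-- An indexed sequence is zero-sum if its sum is `0`. -/
def IsZeroSum (S : IndexedSeq G) : Prop :=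
  S.sigma = 0

/-- Irreducible (minimal zero-sum) indexed sequences: nontrivial, zero-sum, and without a
nontrivial proper zero-sum subsequence. -/
def IsIrreducible (S : IndexedSeq G) : Prop :=
  S ≠ 0 ∧ S.IsZeroSum ∧ ∀ T : IndexedSeq G, T ≤ S → T ≠ 0 → T.IsZeroSum → T = S

/-- `Z`, a formal product of irreducible indexed sequences, is an irreducible factorization
of `S`: the product of its factors is `S` (multisets are written additively). -/
def IsFactorization (S : IndexedSeq G) (Z : Multiset (IndexedSeq G)) : Prop :=
  (∀ U ∈ Z, U.IsIrreducible) ∧ Z.sum = S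

/-- A unique factorization indexed sequence (UFIS): a squarefree zero-sum indexed sequence with
exactly one irreducible factorization. -/
def IsUFIS (S : IndexedSeq G) : Prop :=
  S.Nodup ∧ S.IsZeroSum ∧ ∃! Z : Multiset (IndexedSeq G), S.IsFactorization Z

/-- The cross number of an indexed sequence: the sum of the inverse orders of its terms. -/
noncomputable def crossNumber (S : IndexedSeq G) : ℚ :=
  (S.map fun x => 1 / (addOrderOf (x.1 : G) : ℚ)).sum

end IndexedSeq

/-- `x` is the constant `K₁(G)`: the maximum of the cross numbers of the unique factorization
indexed sequences over `G` (in particular this maximum exists). -/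
def IsKOne (G : Type*) [AddCommGroup G] (x : ℚ) : Prop :=
  IsGreatest {k : ℚ | ∃ S : IndexedSeq G, S.IsUFIS ∧ S.crossNumber = k} x

/-! ### The conjectured value -/

/-- A decomposition of `G` as a finite direct sum of cyclic groups of prime power order
(trivial summands, with exponent `0`, are allowed). -/
structure PrimaryDecomposition (G : Type*) [AddCommGroup G] where
  ι : Type
  [fintype : Fintype ι]
  p : ι → ℕ
  prime : ∀ i, (p i).Prime
  e : ι → ℕ
  equiv : G ≃+ ⨁ i, ZMod (p i ^ e i)

attribute [instance] PrimaryDecomposition.fintype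

/-- The term `(p ^ e - 1) / (p ^ e - p ^ (e - 1))` of a summand of order `p ^ e`; it is `0` for a
trivial summand (`e = 0`). -/
def kOneTerm (p e : ℕ) : ℚ :=
  ((p : ℚ) ^ e - 1) / ((p : ℚ) ^ e - (p : ℚ) ^ (e - 1))

/-- The sum of `(p ^ e - 1) / (p ^ e - p ^ (e - 1))` over the summands of a decomposition. -/
def PrimaryDecomposition.kOneSum {G : Type*} [AddCommGroup G] (D : PrimaryDecomposition G) : ℚ :=
  ∑ i, kOneTerm (D.p i) (D.e i)

theorem nonempty_primaryDecomposition (G : Type*) [AddCommGroup G] [Finite G] :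
    Nonempty (PrimaryDecomposition G) := by
  obtain ⟨ι, hι, p, hp, e, ⟨f⟩⟩ := AddCommGroup.equiv_directSum_zmod_of_finite G
  exact ⟨⟨ι, p, hp, e, f⟩⟩

/-- `K₁*(G)`, computed from a decomposition of `G` into cyclic groups of prime power order. It
does not depend on the decomposition: see `kOneStar_eq`. -/
noncomputable def kOneStar (G : Type*) [AddCommGroup G] [Finite G] : ℚ :=
  (Classical.choice (nonempty_primaryDecomposition G)).kOneSum

theorem kOneTerm_eq {p : ℕ} (hp : p.Prime) {e M : ℕ} (hM : e ≤ M) :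
    kOneTerm p e = ∑ j ∈ Finset.range M, ((min (j + 1) e : ℕ) - (min j e : ℕ) : ℚ) / (p : ℚ) ^ j := by
  have hp1 : (p : ℚ) - 1 ≠ 0 := by
    have : (1 : ℚ) < p := by exact_mod_cast hp.one_lt
    linarith
  have hp0 : (p : ℚ) ≠ 0 := by exact_mod_cast hp.ne_zero
  have h1 : ∑ j ∈ Finset.range M, ((min (j + 1) e : ℕ) - (min j e : ℕ) : ℚ) / (p : ℚ) ^ j
      = ∑ j ∈ Finset.range e, 1 / (p : ℚ) ^ j := by
    rw [← Finset.sum_subset (Finset.range_mono hM)]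
    · refine Finset.sum_congr rfl fun j hj => ?_
      have hj := Finset.mem_range.1 hj
      rw [min_eq_left (by omega), min_eq_left (by omega)]
      push_cast
      ring
    · intro j _ hj
      have hj : e ≤ j := by simpa using hj
      rw [min_eq_right (by omega), min_eq_right (by omega)]
      simp
  rw [h1]
  clear h1 hM
  unfold kOneTerm
  rcases e with _ | e
  · simp
  induction e with
  | zero => simp [hp1]
  | succ e ih =>
    rw [Finset.sum_range_succ, ← ih]
    have h2 : ∀ k : ℕ, (p : ℚ) ^ (k + 1) - (p : ℚ) ^ k ≠ 0 := fun k => by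
      rw [pow_succ, show (p : ℚ) ^ k * p - p ^ k = p ^ k * (p - 1) by ring]
      exact mul_ne_zero (pow_ne_zero _ hp0) hp1
    have h3 := h2 e
    have h4 := h2 (e + 1)
    simp only [Nat.add_sub_cancel]
    have h5 : (p : ℚ) ^ (e + 1) ≠ 0 := pow_ne_zero _ hp0
    rw [div_add_div _ _ h3 h5, div_eq_div_iff h4 (mul_ne_zero h3 h5)]
    ring

theorem card_nsmul_eq_zero_zmod (m d : ℕ) [NeZero m] :
    Nat.card {x : ZMod m // d • x = 0} = m.gcd d := by
  have h := IsAddCyclic.card_nsmulAddMonoidHom_ker (G := ZMod m) d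
  rw [Nat.card_zmod] at h
  rw [← h]
  rfl

/-- The order of the `d`-torsion of `G` in terms of a decomposition. -/
theorem PrimaryDecomposition.card_torsion {G : Type*} [AddCommGroup G]
    (D : PrimaryDecomposition G) (d : ℕ) :
    Nat.card {x : G // d • x = 0} = ∏ i, (D.p i ^ D.e i).gcd d := by
  have hne : ∀ i, NeZero (D.p i ^ D.e i) := fun i => ⟨pow_ne_zero _ (D.prime i).ne_zero⟩
  have f : G ≃+ ∀ i, ZMod (D.p i ^ D.e i) := D.equiv.trans (DirectSum.addEquivProd _)
  have g : {x : G // d • x = 0} ≃ ∀ i, {y : ZMod (D.p i ^ D.e i) // d • y = 0} :=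
    (f.toEquiv.subtypeEquiv (q := fun y => ∀ i, d • y i = 0) fun x => by
      rw [← f.map_eq_zero_iff, map_nsmul, funext_iff]
      rfl).trans
      (Equiv.subtypePiEquivPi (p := fun i (y : ZMod (D.p i ^ D.e i)) => d • y = 0))
  rw [Nat.card_congr g, Nat.card_pi]
  exact Finset.prod_congr rfl fun i _ => card_nsmul_eq_zero_zmod _ _

theorem PrimaryDecomposition.factorization_card {G : Type*} [AddCommGroup G]
    (D : PrimaryDecomposition G) {p : ℕ} (hp : p.Prime) (k : ℕ) :
    (Nat.card {x : G // p ^ k • x = 0}).factorization p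
      = ∑ i, min k ((D.p i ^ D.e i).factorization p) := by
  rw [D.card_torsion, Nat.factorization_prod]
  · rw [Finset.sum_apply']
    refine Finset.sum_congr rfl fun i _ => ?_
    rw [Nat.factorization_gcd (pow_ne_zero _ (D.prime i).ne_zero) (pow_ne_zero _ hp.ne_zero)]
    simp [hp.factorization, min_comm]
  · intro i _
    exact (Nat.gcd_pos_of_pos_right _ (pow_pos hp.pos _)).ne'

theorem PrimaryDecomposition.kOneSum_eq {G : Type*} [AddCommGroup G]
    (D : PrimaryDecomposition G) (P : Finset ℕ) (hP : ∀ p ∈ P, p.Prime) (hD : ∀ i, D.p i ∈ P)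
    (M : ℕ) (hM : ∀ i, D.e i ≤ M) :
    D.kOneSum = ∑ p ∈ P, ∑ j ∈ Finset.range M,
      (((Nat.card {x : G // p ^ (j + 1) • x = 0}).factorization p : ℚ)
        - ((Nat.card {x : G // p ^ j • x = 0}).factorization p : ℚ)) / (p : ℚ) ^ j := by
  have h1 : ∀ i, kOneTerm (D.p i) (D.e i) = ∑ p ∈ P, ∑ j ∈ Finset.range M,
      ((min (j + 1) ((D.p i ^ D.e i).factorization p) : ℕ)
        - (min j ((D.p i ^ D.e i).factorization p) : ℕ) : ℚ) / (p : ℚ) ^ j := by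
    intro i
    rw [Finset.sum_eq_single_of_mem (D.p i) (hD i), kOneTerm_eq (D.prime i) (hM i)]
    · simp [(D.prime i).factorization]
    · intro p _ hp
      simp [(D.prime i).factorization, hp.symm]
  unfold kOneSum
  rw [Finset.sum_congr rfl fun i _ => h1 i, Finset.sum_comm]
  refine Finset.sum_congr rfl fun p hp => ?_
  rw [Finset.sum_comm]
  refine Finset.sum_congr rfl fun j _ => ?_
  rw [D.factorization_card (hP p hp), D.factorization_card (hP p hp), ← Finset.sum_div]
  push_cast
  rw [Finset.sum_sub_distrib]

/-- The value `K₁*(G)` may be computed from any decomposition of `G` as a direct sum of cyclic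
groups of prime power order. -/
theorem kOneStar_eq {G : Type*} [AddCommGroup G] [Finite G] (D : PrimaryDecomposition G) :
    kOneStar G = D.kOneSum := by
  unfold kOneStar
  generalize Classical.choice (nonempty_primaryDecomposition G) = D'
  classical
  have hP : ∀ p ∈ Finset.univ.image D'.p ∪ Finset.univ.image D.p, p.Prime := by
    intro p hp
    rcases Finset.mem_union.1 hp with h | h
    · obtain ⟨i, _, rfl⟩ := Finset.mem_image.1 h
      exact D'.prime i
    · obtain ⟨i, _, rfl⟩ := Finset.mem_image.1 h
      exact D.prime i
  have hM' : ∀ i, D'.e i ≤ ∑ i, D'.e i + ∑ i, D.e i := fun i =>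
    (Finset.single_le_sum (f := D'.e) (fun _ _ => Nat.zero_le _) (Finset.mem_univ i)).trans
      (Nat.le_add_right _ _)
  have hM : ∀ i, D.e i ≤ ∑ i, D'.e i + ∑ i, D.e i := fun i =>
    (Finset.single_le_sum (f := D.e) (fun _ _ => Nat.zero_le _) (Finset.mem_univ i)).trans
      (Nat.le_add_left _ _)
  rw [D'.kOneSum_eq _ hP (fun i => by simp) _ hM', D.kOneSum_eq _ hP (fun i => by simp) _ hM]

/-! ### 2-wide integers -/

/-- The prime `p` is 2-wide with respect to the positive integer `n`. -/
def TwoWideWrt (p n : ℕ) : Prop :=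
  p.Prime ∧ 0 < n ∧ ¬ p ∣ n ∧
    ∏ q ∈ n.primeFactors,
        ((q : ℚ) ^ (n.factorization q + 1) - 1) /
          ((q : ℚ) ^ (n.factorization q + 1) - (q : ℚ) ^ n.factorization q)
      ≤ ((p : ℚ) ^ 2 + 2 * p - 2) / (p : ℚ) ^ 2

/-- The positive integer `n` is 2-wide: every prime factor of `n` other than the largest one is
2-wide with respect to the part of `n` composed of the larger prime factors. -/
def TwoWide (n : ℕ) : Prop :=
  0 < n ∧ ∀ p ∈ n.primeFactors, (∃ q ∈ n.primeFactors, p < q) →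
    TwoWideWrt p (∏ q ∈ n.primeFactors with p < q, q ^ n.factorization q)

/-- `q` is the largest prime factor of `n`. -/
def IsLargestPrimeFactor (n q : ℕ) : Prop :=
  IsGreatest {p : ℕ | p.Prime ∧ p ∣ n} q

/-- `q` is the second largest (distinct) prime factor of `n`. -/
def IsSecondLargestPrimeFactor (n q : ℕ) : Prop :=
  ∃ r, IsLargestPrimeFactor n r ∧ IsGreatest {p : ℕ | p.Prime ∧ p ∣ n ∧ p ≠ r} q

/-!
The zero-sum subsequences of a unique factorization indexed sequence are closed under
intersection, and conversely a zero-sum family with this property factors uniquely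
(`IndexedSeq.IsUFIS.uniqueZeroSums`, `IndexedSeq.isUFIS_of_uniqueZeroSums`). The property
`UniqueZeroSums` passes to subfamilies and to families in which several terms are replaced by
their sum, and it is the only thing used about factorizations. Write `geomSum p a` for `1 + 1 / p
+ ⋯ + 1 / p ^ (a - 1)`; then `K₁*` of `ZMod n` is the sum of the `geomSum p (v_p n)`, and the
additional summand `ZMod q` contributes `1`.

*Lower bound.* Along a chain of subgroups of prime index, each step of index `p` allows to add a
block of `p` terms congruent to an element `u` modulo the smaller group, with sum zero. A zero sum
contains all or none of them, so unique zero sums are kept (`Attains.add_block`). For `u` of order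
`p ^ (j + 1)` this adds `1 / p ^ j` to the cross number.

*Upper bound.* The bound is proved for all families with unique zero sums, by induction on the set
of primes dividing the exponent, in decreasing order (`TwoWide.crossBound_extend`). One may assume
that merging terms always lowers the cross number (`crossBound_of_reduced`). In such a reduced
family at most `p` terms have a given order divisible by `p`, if the `p`-torsion is cyclic
(`UniqueZeroSums.card_filter_order_le`), by the bound `p` for the group of order `p`, which
follows from the Cauchy–Davenport theorem. If the sums of the terms of order `p` cover the whole
`p`-torsion, then the remaining terms, multiplied by `p`, again have unique zero sums, and
induction applies (`UniqueZeroSums.cross_le_of_cover`). By Cauchy–Davenport this is the case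
unless at most `p - 2` terms have order `p`, and then the count by orders, together with the
inequality in the definition of `2`-wideness, gives the bound (`CrossBound.prime_pow_mul`).

For `ZMod n × ZMod q` the `q`-torsion is a plane over the field with `q` elements, and the
essential fact is that a family of nonzero vectors with unique zero sums in the plane over `ZMod
p` has at most `2 * p` terms (`UniqueZeroSums.card_le_of_plane`). It is proved in the group
algebra over `ZMod p`, where the augmentation ideal `I` satisfies `I ^ (2 * p - 1) = 0`: if the
terms allow to construct an element of `I ^ o`, supported on subset sums and with nonzero
coefficient at the neutral element, then `o ≤ 2 * p - 2`. The product of `1 - X ^ g` over the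
terms `g` of a zero-sum family need not have a nonzero coefficient there, because for odd `p` the
minimal zero-sum subfamilies of odd length contribute `1 - 1 = 0`, and for `p = 2` all of them do.
This is repaired by relations in `I ^ 2` between parallel terms, and in `I ^ 3` between terms of
two such subfamilies, so that at most one factor is lost. If all terms of some minimal zero-sum
subfamily are equal, these relations are not available, but then the bound follows by projecting
along the line of these terms. Since `q` is one of the two largest primes, the induction over
primes starts with `q` alone (`crossBound_prime_pow_of_plane`), or with `q` and one larger prime
(`crossBound_prime_pow_mul_of_plane`), and all smaller primes have cyclic torsion.
-/

/-! ### Families with intersecting zero-sum subfamilies -/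

/-- The zero-sum subfamilies of the finite family `g` restricted to `s` are closed under
intersection. For a zero-sum family this says that it factors uniquely into minimal zero-sum
subfamilies; the condition passes to subfamilies, which need not be zero-sum. -/
def UniqueZeroSums {ι G : Type*} [DecidableEq ι] [AddCommGroup G] (s : Finset ι) (g : ι → G) :
    Prop :=
  ∀ A ⊆ s, ∀ B ⊆ s, ∑ i ∈ A, g i = 0 → ∑ i ∈ B, g i = 0 → ∑ i ∈ A ∩ B, g i = 0

namespace UniqueZeroSums

variable {ι G G' : Type*} [DecidableEq ι] [AddCommGroup G] [AddCommGroup G']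
  {s t : Finset ι} {g : ι → G}

theorem mono (h : UniqueZeroSums s g) (hts : t ⊆ s) : UniqueZeroSums t g :=
  fun A hA B hB => h A (hA.trans hts) B (hB.trans hts)

/-- Only the zero-sum subfamilies matter, so a family may be replaced by any other one with the
same zero-sum subfamilies. -/
theorem congr {f : ι → G'} (h : UniqueZeroSums s g)
    (hfg : ∀ A ⊆ s, ∑ i ∈ A, f i = 0 ↔ ∑ i ∈ A, g i = 0) : UniqueZeroSums s f := by
  intro A hA B hB h1 h2
  rw [hfg _ (Finset.inter_subset_left.trans hA)]
  exact h A hA B hB ((hfg A hA).1 h1) ((hfg B hB).1 h2)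

/-- Replacing a subfamily by the single term which is its sum. -/
theorem merge (h : UniqueZeroSums s g) {T : Finset ι} (hT : T ⊆ s) {i₀ : ι} (hi₀ : i₀ ∈ T) :
    UniqueZeroSums (insert i₀ (s \ T)) (Function.update g i₀ (∑ i ∈ T, g i)) := by
  set g' := Function.update g i₀ (∑ i ∈ T, g i)
  -- `e A` is the subfamily of `s` which the subfamily `A` of the new family stands for
  let e : Finset ι → Finset ι := fun A => if i₀ ∈ A then A.erase i₀ ∪ T else A
  have hsum : ∀ A ⊆ insert i₀ (s \ T), ∑ i ∈ A, g' i = ∑ i ∈ e A, g i := by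
    intro A hA
    by_cases hi : i₀ ∈ A
    · have hd : Disjoint (A.erase i₀) T := by
        rw [Finset.disjoint_left]
        intro i hi1 hi2
        have := hA (Finset.mem_of_mem_erase hi1)
        simp only [Finset.mem_insert, Finset.mem_sdiff] at this
        rcases this with h | h
        · exact (Finset.ne_of_mem_erase hi1) h
        · exact h.2 hi2
      simp only [e, if_pos hi]
      rw [Finset.sum_union hd, ← Finset.sum_erase_add _ _ hi]
      congr 1
      · refine Finset.sum_congr rfl fun i hi => ?_
        simp [g', Function.update_of_ne (Finset.ne_of_mem_erase hi)]
      · simp [g']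
    · simp only [e, if_neg hi]
      refine Finset.sum_congr rfl fun i hi' => ?_
      have : i ≠ i₀ := fun h => hi (h ▸ hi')
      simp [g', Function.update_of_ne this]
  have hsub : ∀ A ⊆ insert i₀ (s \ T), e A ⊆ s := by
    intro A hA i hi
    simp only [e] at hi
    split_ifs at hi with h0
    · rcases Finset.mem_union.1 hi with hi | hi
      · have := hA (Finset.mem_of_mem_erase hi)
        simp only [Finset.mem_insert, Finset.mem_sdiff] at this
        exact (this.resolve_left (Finset.ne_of_mem_erase hi)).1
      · exact hT hi
    · have := hA hi
      simp only [Finset.mem_insert, Finset.mem_sdiff] at this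
      exact (this.resolve_left fun h => h0 (h ▸ hi)).1
  have hinter : ∀ A ⊆ insert i₀ (s \ T), ∀ B ⊆ insert i₀ (s \ T), e (A ∩ B) = e A ∩ e B := by
    intro A hA B hB
    ext i
    have h1 := @hA i
    have h2 := @hB i
    simp only [Finset.mem_insert, Finset.mem_sdiff] at h1 h2
    have h3 : i = i₀ → i ∈ T := fun h => h ▸ hi₀
    simp only [e, Finset.mem_inter]
    by_cases hA0 : i₀ ∈ A <;> by_cases hB0 : i₀ ∈ B <;> simp [hA0, hB0] <;> grind
  intro A hA B hB h1 h2
  rw [hsum _ (Finset.inter_subset_left.trans hA), hinter A hA B hB]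
  exact h _ (hsub A hA) _ (hsub B hB) (hsum A hA ▸ h1) (hsum B hB ▸ h2)

/-- Let `φ` kill the terms in `X`. If every sum of terms outside `X` which lies in the kernel of
`φ` is cancelled by a sum of terms of `X`, then the terms outside `X` still have unique zero sums
after applying `φ`. -/
theorem map_sdiff (h : UniqueZeroSums s g) {X : Finset ι} (hX : X ⊆ s) (φ : G →+ G')
    (hφ : ∀ i ∈ X, φ (g i) = 0)
    (hcov : ∀ T ⊆ s \ X, φ (∑ i ∈ T, g i) = 0 → ∃ Y ⊆ X, ∑ i ∈ Y, g i = -∑ i ∈ T, g i) :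
    UniqueZeroSums (s \ X) fun i => φ (g i) := by
  intro A hA B hB h1 h2
  simp only [← map_sum] at h1 h2 ⊢
  obtain ⟨Y, hY, hAY⟩ := hcov A hA h1
  obtain ⟨Z, hZ, hBZ⟩ := hcov B hB h2
  have hdisj : ∀ C ⊆ s \ X, ∀ W ⊆ X, Disjoint C W := fun C hC W hW =>
    Finset.disjoint_of_subset_left hC (Finset.disjoint_of_subset_right hW Finset.sdiff_disjoint)
  have hsub : ∀ C ⊆ s \ X, ∀ W ⊆ X, C ∪ W ⊆ s := fun C hC W hW =>
    Finset.union_subset (hC.trans Finset.sdiff_subset) (hW.trans hX)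
  have h3 := h (A ∪ Y) (hsub A hA Y hY) (B ∪ Z) (hsub B hB Z hZ)
    (by rw [Finset.sum_union (hdisj A hA Y hY), hAY, add_neg_cancel])
    (by rw [Finset.sum_union (hdisj B hB Z hZ), hBZ, add_neg_cancel])
  have h4 : (A ∪ Y) ∩ (B ∪ Z) = (A ∩ B) ∪ (Y ∩ Z) := by
    have hAZ := hdisj A hA Z hZ
    have hBY := hdisj B hB Y hY
    rw [Finset.disjoint_left] at hAZ hBY
    ext i
    simp only [Finset.mem_inter, Finset.mem_union]
    have := @hAZ i
    have := @hBY i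
    tauto
  have hAB : A ∩ B ⊆ s \ X := Finset.inter_subset_left.trans hA
  have hYZ : Y ∩ Z ⊆ X := Finset.inter_subset_left.trans hY
  rw [h4, Finset.sum_union (hdisj _ hAB _ hYZ)] at h3
  have h5 := congrArg φ h3
  rwa [map_add, map_sum φ _ (Y ∩ Z), Finset.sum_eq_zero fun i hi => hφ i (hYZ hi), add_zero,
    map_zero] at h5

/-- Adding a term which is not the negative of any subsum creates no new zero sums. -/
theorem insertNone (h : UniqueZeroSums s g) {u : G} (hu : ∀ A ⊆ s, ∑ i ∈ A, g i ≠ -u) :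
    UniqueZeroSums (Finset.insertNone s) (fun o : Option ι => o.elim u g) := by
  have key : ∀ A ⊆ Finset.insertNone s, ∑ o ∈ A, o.elim u g = 0 →
      none ∉ A ∧ ∑ i ∈ Finset.eraseNone A, g i = 0 := by
    intro A hA hA0
    have hsub : Finset.eraseNone A ⊆ s := fun i hi => by
      simpa using hA (Finset.mem_eraseNone.1 hi)
    by_cases hn : none ∈ A
    · exfalso
      apply hu _ hsub
      have : A = Finset.insertNone (Finset.eraseNone A) := by
        rw [Finset.insertNone_eraseNone, Finset.insert_eq_of_mem hn]
      rw [this, Finset.sum_insertNone] at hA0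
      exact eq_neg_of_add_eq_zero_right hA0
    · refine ⟨hn, ?_⟩
      have : A = (Finset.eraseNone A).map Function.Embedding.some := by
        rw [Finset.map_some_eraseNone, Finset.erase_eq_of_notMem hn]
      rw [this, Finset.sum_map] at hA0
      exact hA0
  intro A hA B hB h1 h2
  obtain ⟨hA1, hA2⟩ := key A hA h1
  obtain ⟨hB1, hB2⟩ := key B hB h2
  have hs : ∀ C ⊆ Finset.insertNone s, Finset.eraseNone C ⊆ s := fun C hC i hi => by
    simpa using hC (Finset.mem_eraseNone.1 hi)
  have h3 := h _ (hs A hA) _ (hs B hB) hA2 hB2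
  have : A ∩ B = (Finset.eraseNone A ∩ Finset.eraseNone B).map Function.Embedding.some := by
    ext o
    cases o <;> simp [hA1]
  rw [this, Finset.sum_map]
  exact h3

end UniqueZeroSums

/-! ### Sums in cyclic groups of prime order -/

open scoped Pointwise in
/-- By the Cauchy–Davenport theorem, `p - 1` nonzero residues modulo `p` have all subset sums. -/
theorem exists_subset_sum_eq_of_prime {ι : Type*} {p : ℕ} [Fact p.Prime] {s : Finset ι}
    {f : ι → ZMod p} (hf : ∀ i ∈ s, f i ≠ 0) (hs : p - 1 ≤ s.card) (v : ZMod p) :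
    ∃ A ⊆ s, ∑ i ∈ A, f i = v := by
  classical
  have hp : p.Prime := Fact.out
  -- the set of subset sums grows with every further term, until it is everything
  have key : ∀ s : Finset ι, (∀ i ∈ s, f i ≠ 0) →
      min p (s.card + 1) ≤ (s.powerset.image fun A => ∑ i ∈ A, f i).card := by
    intro s
    induction s using Finset.induction_on with
    | empty => intro _; simp
    | insert a s ha ih =>
      intro hf
      have ih := ih fun i hi => hf i (Finset.mem_insert_of_mem hi)
      have hfa := hf a (Finset.mem_insert_self a s)
      set W := s.powerset.image fun A => ∑ i ∈ A, f i
      have hW : W.Nonempty := ⟨_, Finset.mem_image_of_mem _ (Finset.empty_mem_powerset s)⟩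
      have hcd := ZMod.cauchy_davenport hp hW (t := ({0, f a} : Finset (ZMod p))) (by simp)
      have hsub : W + ({0, f a} : Finset (ZMod p))
          ⊆ (insert a s).powerset.image fun A => ∑ i ∈ A, f i := by
        intro x hx
        obtain ⟨w, hw, y, hy, rfl⟩ := Finset.mem_add.1 hx
        obtain ⟨A, hA, rfl⟩ := Finset.mem_image.1 hw
        rw [Finset.mem_powerset] at hA
        rw [Finset.mem_image]
        simp only [Finset.mem_insert, Finset.mem_singleton] at hy
        rcases hy with rfl | rfl
        · exact ⟨A, Finset.mem_powerset.2 (hA.trans (Finset.subset_insert _ _)), by simp⟩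
        · refine ⟨insert a A, Finset.mem_powerset.2 (Finset.insert_subset_insert _ hA), ?_⟩
          rw [Finset.sum_insert fun h => ha (hA h), add_comm]
      have h1 := hcd.trans (Finset.card_le_card hsub)
      rw [Finset.card_pair (Ne.symm hfa)] at h1
      rw [Finset.card_insert_of_notMem ha]
      have h2 : min p (s.card + 1 + 1) ≤ min p (W.card + 2 - 1) := by omega
      exact h2.trans h1
  have h := key s hf
  have hpos := hp.pos
  have h1 : (Finset.univ : Finset (ZMod p)).card
      ≤ (s.powerset.image fun A => ∑ i ∈ A, f i).card := by
    rw [Finset.card_univ, ZMod.card]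
    omega
  have h2 := Finset.eq_univ_of_card _ (le_antisymm (Finset.card_le_univ _) h1)
  have h3 : v ∈ s.powerset.image fun A => ∑ i ∈ A, f i := h2 ▸ Finset.mem_univ v
  obtain ⟨A, hA, rfl⟩ := Finset.mem_image.1 h3
  exact ⟨A, Finset.mem_powerset.1 hA, rfl⟩

/-- With more than `p` terms, any term lies in a zero-sum subfamily avoiding any other given term;
intersecting these would isolate a single term. -/
theorem UniqueZeroSums.card_le_of_prime {ι : Type*} [DecidableEq ι] {p : ℕ} [Fact p.Prime]
    {s : Finset ι} {f : ι → ZMod p} (h : UniqueZeroSums s f) (hf : ∀ i ∈ s, f i ≠ 0) :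
    s.card ≤ p := by
  by_contra! hcard
  have hp : p.Prime := Fact.out
  obtain ⟨x, hx⟩ : s.Nonempty := Finset.card_pos.1 (by omega)
  have key : ∀ t ⊆ s.erase x, ∃ A ⊆ s, x ∈ A ∧ Disjoint A t ∧ ∑ i ∈ A, f i = 0 := by
    intro t
    induction t using Finset.induction_on with
    | empty =>
      intro _
      obtain ⟨A, hA, hA0⟩ := exists_subset_sum_eq_of_prime (s := s.erase x)
        (fun i hi => hf i (Finset.mem_of_mem_erase hi))
        (by rw [Finset.card_erase_of_mem hx]; omega) (-f x)
      refine ⟨insert x A, Finset.insert_subset hx (hA.trans (Finset.erase_subset _ _)),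
        Finset.mem_insert_self _ _, Finset.disjoint_empty_right _, ?_⟩
      rw [Finset.sum_insert fun h => Finset.notMem_erase x s (hA h), hA0, add_neg_cancel]
    | insert y t _ ih =>
      intro ht
      obtain ⟨A, hA, hxA, hAt, hA0⟩ := ih ((Finset.subset_insert _ _).trans ht)
      have hy := ht (Finset.mem_insert_self y t)
      obtain ⟨B, hB, hB0⟩ := exists_subset_sum_eq_of_prime (s := (s.erase x).erase y)
        (fun i hi => hf i (Finset.mem_of_mem_erase (Finset.mem_of_mem_erase hi)))
        (by rw [Finset.card_erase_of_mem hy, Finset.card_erase_of_mem hx]; omega) (-f x)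
      have hBs : insert x B ⊆ s := Finset.insert_subset hx
        (hB.trans ((Finset.erase_subset _ _).trans (Finset.erase_subset _ _)))
      have hxB : x ∉ B := fun h => Finset.notMem_erase x s (Finset.mem_of_mem_erase (hB h))
      refine ⟨A ∩ insert x B, Finset.inter_subset_left.trans hA,
        Finset.mem_inter.2 ⟨hxA, Finset.mem_insert_self _ _⟩, ?_, ?_⟩
      · rw [Finset.disjoint_insert_right]
        refine ⟨fun hyA => ?_, hAt.mono_left Finset.inter_subset_left⟩
        rcases Finset.mem_insert.1 (Finset.mem_inter.1 hyA).2 with h | h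
        · exact Finset.ne_of_mem_erase hy h
        · exact Finset.notMem_erase _ _ (hB h)
      · refine h A hA _ hBs hA0 ?_
        rw [Finset.sum_insert hxB, hB0, add_neg_cancel]
  obtain ⟨A, hA, hxA, hAt, hA0⟩ := key _ subset_rfl
  have : A = {x} := by
    refine Finset.eq_singleton_iff_unique_mem.2 ⟨hxA, fun y hy => ?_⟩
    by_contra hyx
    exact Finset.disjoint_left.1 hAt hy (Finset.mem_erase.2 ⟨hyx, hA hy⟩)
  rw [this, Finset.sum_singleton] at hA0
  exact hf x hx hA0

/-! ### The group algebra of an elementary abelian group of rank two -/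

/-- The determinant of two vectors of the plane over `ZMod p`; it vanishes exactly when they are
parallel. -/
def det₂ {R : Type*} [CommRing R] (u v : R × R) : R := u.1 * v.2 - u.2 * v.1

namespace PlaneAlgebra

open AddMonoidAlgebra

variable {p : ℕ}

variable (p) in
/-- The group algebra of the plane over `ZMod p`. -/
abbrev Alg : Type := AddMonoidAlgebra (ZMod p) (ZMod p × ZMod p)

/-- The element `1 - X ^ v` of the group algebra. -/
noncomputable def oneSub (v : ZMod p × ZMod p) : Alg p := 1 - single v 1

variable (p) in
/-- The augmentation ideal, generated by the elements `1 - X ^ v`. -/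
noncomputable def augIdeal : Ideal (Alg p) := Ideal.span (Set.range oneSub)

variable (p) in
/-- The coefficient at the neutral element. -/
noncomputable def coeffZero : Alg p →ₗ[ZMod p] ZMod p where
  toFun θ := θ.coeff 0
  map_add' _ _ := rfl
  map_smul' _ _ := rfl

theorem coeffZero_single (v : ZMod p × ZMod p) :
    coeffZero p (single v 1) = if v = 0 then 1 else 0 := by
  change (single v (1 : ZMod p) : Alg p).coeff 0 = _
  rw [coeff_single, Finsupp.single_apply]

theorem oneSub_mem (v : ZMod p × ZMod p) : oneSub v ∈ augIdeal p :=
  Ideal.subset_span ⟨v, rfl⟩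

theorem oneSub_zero : oneSub (0 : ZMod p × ZMod p) = 0 := by
  simp [oneSub, one_def]

theorem oneSub_add (u v : ZMod p × ZMod p) :
    oneSub (u + v) = oneSub u + oneSub v - oneSub u * oneSub v := by
  have : (single (u + v) 1 : Alg p) = single u 1 * single v 1 := by
    rw [single_mul_single, one_mul]
  simp only [oneSub, this]
  ring

theorem oneSub_nsmul (v : ZMod p × ZMod p) (n : ℕ) :
    ∃ t, oneSub (n • v) = (n : ZMod p) • oneSub v + oneSub v ^ 2 * t := by
  induction n with
  | zero => exact ⟨0, by simp [oneSub_zero]⟩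
  | succ n ih =>
    obtain ⟨t, ht⟩ := ih
    refine ⟨t - (n : ZMod p) • 1 - oneSub v * t, ?_⟩
    rw [succ_nsmul, oneSub_add, ht]
    push_cast
    rw [add_smul, one_smul]
    simp only [Algebra.smul_def]
    ring

variable [Fact p.Prime]

theorem oneSub_smul (c : ZMod p) (v : ZMod p × ZMod p) :
    ∃ t, oneSub (c • v) = c • oneSub v + oneSub v ^ 2 * t := by
  obtain ⟨t, ht⟩ := oneSub_nsmul v c.val
  refine ⟨t, ?_⟩
  rw [ZMod.natCast_zmod_val] at ht
  rw [← ht]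
  congr 1
  rw [← Nat.cast_smul_eq_nsmul (ZMod p), ZMod.natCast_zmod_val]

theorem oneSub_smul_sub_mem (c : ZMod p) (v : ZMod p × ZMod p) :
    oneSub (c • v) - c • oneSub v ∈ augIdeal p ^ 2 := by
  obtain ⟨t, ht⟩ := oneSub_smul c v
  rw [ht, add_sub_cancel_left]
  exact Ideal.mul_mem_right _ _ (Ideal.pow_mem_pow (oneSub_mem v) 2)

theorem oneSub_pow_eq_zero (v : ZMod p × ZMod p) : oneSub v ^ p = 0 := by
  have : CharP (Alg p) p :=
    charP_of_injective_algebraMap (algebraMap (ZMod p) (Alg p)).injective p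
  rw [oneSub, sub_pow_char, one_pow, single_pow, one_pow]
  have : p • v = 0 := by ext <;> simp
  rw [this, one_def, sub_self]

theorem exists_sub_mem_augIdeal (b : Alg p) :
    ∃ c : ZMod p, b - algebraMap (ZMod p) (Alg p) c ∈ augIdeal p := by
  have hb : b ∈ Submodule.span (ZMod p) (Set.range fun v => (single v 1 : Alg p)) := by
    have : b = ∑ v ∈ b.coeff.support, b.coeff v • (single v 1 : Alg p) := by
      apply coeff_injective
      ext v
      simp [coeff_sum, Finsupp.single_apply, Finsupp.finsetSum_apply]
    rw [this]
    exact Submodule.sum_mem _ fun v _ =>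
      Submodule.smul_mem _ _ (Submodule.subset_span ⟨v, rfl⟩)
  induction hb using Submodule.span_induction with
  | mem x hx =>
    obtain ⟨v, rfl⟩ := hx
    refine ⟨1, ?_⟩
    have : (single v 1 : Alg p) - algebraMap (ZMod p) (Alg p) 1 = -oneSub v := by
      rw [oneSub, map_one, neg_sub]
    simp only [this]
    exact neg_mem (oneSub_mem v)
  | zero => exact ⟨0, by simp⟩
  | add x y _ _ hx hy =>
    obtain ⟨c, hc⟩ := hx
    obtain ⟨d, hd⟩ := hy
    refine ⟨c + d, ?_⟩
    rw [map_add, add_sub_add_comm]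
    exact add_mem hc hd
  | smul a x _ hx =>
    obtain ⟨c, hc⟩ := hx
    refine ⟨a * c, ?_⟩
    rw [Algebra.smul_def, map_mul, ← mul_sub]
    exact Ideal.mul_mem_left _ _ hc

theorem eq_smul_add_smul {u w : ZMod p × ZMod p} (h : det₂ u w ≠ 0) (v : ZMod p × ZMod p) :
    v = (det₂ v w / det₂ u w) • u + (det₂ u v / det₂ u w) • w := by
  have h1 : det₂ u w • v = det₂ v w • u + det₂ u v • w := by
    ext <;> simp [det₂] <;> ring
  rw [div_eq_inv_mul, div_eq_inv_mul, mul_smul, mul_smul, ← smul_add, ← h1, smul_smul,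
    inv_mul_cancel₀ h, one_smul]

theorem augIdeal_eq_span_pair {u w : ZMod p × ZMod p} (h : det₂ u w ≠ 0) :
    augIdeal p = Ideal.span {oneSub u, oneSub w} := by
  have hmul : ∀ (c : ZMod p) (v : ZMod p × ZMod p), oneSub (c • v) ∈ Ideal.span {oneSub v} := by
    intro c v
    obtain ⟨t, ht⟩ := oneSub_smul c v
    rw [Ideal.mem_span_singleton', ht]
    exact ⟨algebraMap _ _ c + oneSub v * t, by rw [Algebra.smul_def]; ring⟩
  apply le_antisymm
  · rw [augIdeal, Ideal.span_le]
    rintro _ ⟨v, rfl⟩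
    rw [eq_smul_add_smul h v, oneSub_add]
    have h1 := Ideal.span_mono (by simp) (hmul (det₂ v w / det₂ u w) u) (t := {oneSub u, oneSub w})
    have h2 := Ideal.span_mono (by simp) (hmul (det₂ u v / det₂ u w) w) (t := {oneSub u, oneSub w})
    exact sub_mem (add_mem h1 h2) (Ideal.mul_mem_left _ _ h2)
  · rw [Ideal.span_le]
    rintro x hx
    rcases hx with rfl | rfl
    · exact oneSub_mem _
    · exact oneSub_mem _

/-- The augmentation ideal has two generators whose `p`-th powers vanish. -/
theorem augIdeal_pow_eq_bot : augIdeal p ^ (2 * p - 1) = ⊥ := by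
  have hp : 0 < p := (Fact.out : p.Prime).pos
  rw [augIdeal_eq_span_pair (u := (1, 0)) (w := (0, 1)) (by simp [det₂]), Ideal.span_insert,
    ← Ideal.add_eq_sup, add_pow, Ideal.sum_eq_sup, eq_bot_iff]
  refine Finset.sup_le fun i _ => ?_
  have h0 : ∀ v : ZMod p × ZMod p, ∀ i, p ≤ i →
      Ideal.span {oneSub v} ^ i = (⊥ : Ideal (Alg p)) := by
    intro v i hi
    rw [Ideal.span_singleton_pow, ← Nat.sub_add_cancel hi, pow_add, oneSub_pow_eq_zero, mul_zero,
      Ideal.span_singleton_eq_bot]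
  by_cases hi : p ≤ i
  · rw [h0 _ _ hi]
    simp
  · rw [h0 _ (2 * p - 1 - i) (by omega)]
    simp

/-- Modulo `I ^ 2`, the augmentation ideal `I` is spanned by `1 - X ^ u` and `1 - X ^ w`. -/
theorem exists_sub_mem_sq {u w : ZMod p × ZMod p} (h : det₂ u w ≠ 0) {θ : Alg p}
    (hθ : θ ∈ augIdeal p) :
    ∃ c d : ZMod p, θ - (c • oneSub u + d • oneSub w) ∈ augIdeal p ^ 2 := by
  rw [augIdeal_eq_span_pair h, Ideal.mem_span_pair] at hθ
  obtain ⟨a, b, rfl⟩ := hθ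
  obtain ⟨c, hc⟩ := exists_sub_mem_augIdeal a
  obtain ⟨d, hd⟩ := exists_sub_mem_augIdeal b
  refine ⟨c, d, ?_⟩
  have : a * oneSub u + b * oneSub w - (c • oneSub u + d • oneSub w)
      = (a - algebraMap _ _ c) * oneSub u + (b - algebraMap _ _ d) * oneSub w := by
    simp only [Algebra.smul_def]
    ring
  rw [this, sq]
  exact add_mem (Ideal.mul_mem_mul hc (oneSub_mem u)) (Ideal.mul_mem_mul hd (oneSub_mem w))

/-- Modulo `I ^ 3`, the ideal `I ^ 2` is spanned by the pairwise products of `1 - X ^ x`,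
`1 - X ^ y` and `1 - X ^ z`, for pairwise independent `x`, `y`, `z`. -/
theorem exists_sub_mem_cube {x y z : ZMod p × ZMod p} (hxy : det₂ x y ≠ 0) (hyz : det₂ y z ≠ 0)
    (hzx : det₂ z x ≠ 0) {θ : Alg p} (hθ : θ ∈ augIdeal p ^ 2) :
    ∃ c d e : ZMod p, θ - (c • (oneSub x * oneSub y) + d • (oneSub x * oneSub z)
      + e • (oneSub y * oneSub z)) ∈ augIdeal p ^ 3 := by
  set I := augIdeal p
  set a := oneSub x
  set b := oneSub y
  set c := oneSub z
  have ha : a ∈ I := oneSub_mem x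
  have hb : b ∈ I := oneSub_mem y
  have hc : c ∈ I := oneSub_mem z
  have hI3 : I ^ 3 = I ^ 2 * I := pow_succ I 2
  let S : Submodule (ZMod p) (Alg p) :=
    Submodule.span (ZMod p) {a * b, a * c, b * c} ⊔ (I ^ 3).restrictScalars (ZMod p)
  have hab : a * b ∈ S := Submodule.mem_sup_left (Submodule.subset_span (by simp))
  have hac : a * c ∈ S := Submodule.mem_sup_left (Submodule.subset_span (by simp))
  have hbc : b * c ∈ S := Submodule.mem_sup_left (Submodule.subset_span (by simp))
  have hcube : ∀ θ ∈ I ^ 3, θ ∈ S := fun θ hθ => Submodule.mem_sup_right hθ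
  -- the linear relation between `x`, `y`, `z` expresses the squares by the mixed products
  obtain ⟨r, hr, hcr⟩ : ∃ r ∈ I ^ 2,
      c = (det₂ z y / det₂ x y) • a + (det₂ x z / det₂ x y) • b + r := by
    refine ⟨c - ((det₂ z y / det₂ x y) • a + (det₂ x z / det₂ x y) • b), ?_, by abel⟩
    have h1 := oneSub_smul_sub_mem (det₂ z y / det₂ x y) x
    have h2 := oneSub_smul_sub_mem (det₂ x z / det₂ x y) y
    have h3 : oneSub ((det₂ z y / det₂ x y) • x) * oneSub ((det₂ x z / det₂ x y) • y) ∈ I ^ 2 := by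
      rw [sq]
      exact Ideal.mul_mem_mul (oneSub_mem _) (oneSub_mem _)
    have h4 := sub_mem (add_mem h1 h2) h3
    have h5 : c = oneSub ((det₂ z y / det₂ x y) • x + (det₂ x z / det₂ x y) • y) := by
      rw [← eq_smul_add_smul hxy z]
    rw [h5, oneSub_add]
    convert h4 using 1
    abel
  have hk : det₂ z y / det₂ x y ≠ 0 :=
    div_ne_zero (fun h => hyz (by simp only [det₂] at h ⊢; linear_combination -h)) hxy
  have hl : det₂ x z / det₂ x y ≠ 0 :=
    div_ne_zero (fun h => hzx (by simp only [det₂] at h ⊢; linear_combination -h)) hxy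
  generalize det₂ z y / det₂ x y = k at hcr hk
  generalize det₂ x z / det₂ x y = l at hcr hl
  have haa : a * a ∈ S := by
    have : k • (a * a) = a * c - l • (a * b) - r * a := by
      rw [hcr]
      simp only [Algebra.smul_def]
      ring
    rw [← S.smul_mem_iff hk, this]
    exact sub_mem (sub_mem hac (S.smul_mem _ hab)) (hcube _ (hI3 ▸ Ideal.mul_mem_mul hr ha))
  have hbb : b * b ∈ S := by
    have : l • (b * b) = b * c - k • (a * b) - r * b := by
      rw [hcr]
      simp only [Algebra.smul_def]
      ring
    rw [← S.smul_mem_iff hl, this]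
    exact sub_mem (sub_mem hbc (S.smul_mem _ hab)) (hcube _ (hI3 ▸ Ideal.mul_mem_mul hr hb))
  have hS : θ ∈ S := by
    rw [sq] at hθ
    refine Submodule.mul_induction_on hθ (fun m hm n hn => ?_) fun m n hm hn => add_mem hm hn
    obtain ⟨c₁, d₁, h₁⟩ := exists_sub_mem_sq hxy hm
    obtain ⟨c₂, d₂, h₂⟩ := exists_sub_mem_sq hxy hn
    have h3 : (c₂ • a + d₂ • b) ∈ I := by
      simp only [Algebra.smul_def]
      exact add_mem (Ideal.mul_mem_left _ _ ha) (Ideal.mul_mem_left _ _ hb)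
    have : m * n = (m - (c₁ • a + d₁ • b)) * (c₂ • a + d₂ • b) + (n - (c₂ • a + d₂ • b)) * m
        + ((c₁ * c₂) • (a * a) + (c₁ * d₂ + d₁ * c₂) • (a * b) + (d₁ * d₂) • (b * b)) := by
      simp only [Algebra.smul_def, map_mul, map_add]
      ring
    rw [this]
    refine add_mem (add_mem (hcube _ ?_) (hcube _ ?_)) (add_mem (add_mem ?_ ?_) ?_)
    · exact hI3 ▸ Ideal.mul_mem_mul h₁ h3
    · exact hI3 ▸ Ideal.mul_mem_mul h₂ hm
    · exact S.smul_mem _ haa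
    · exact S.smul_mem _ hab
    · exact S.smul_mem _ hbb
  obtain ⟨m, hm, n, hn, rfl⟩ := Submodule.mem_sup.1 hS
  rw [Submodule.mem_span_triple] at hm
  obtain ⟨c', d', e', rfl⟩ := hm
  exact ⟨c', d', e', by rw [add_sub_cancel_left]; exact hn⟩

/-- A linear relation between pairwise independent vectors lifts to a relation in `I ^ 3`. -/
theorem exists_relation_of_det_ne_zero {x y z : ZMod p × ZMod p} (hxy : det₂ x y ≠ 0)
    (hyz : det₂ y z ≠ 0) (hzx : det₂ z x ≠ 0) :
    ∃ c d e : ZMod p, det₂ y z • oneSub x + det₂ z x • oneSub y + det₂ x y • oneSub z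
      + c • (oneSub x * oneSub y) + d • (oneSub x * oneSub z) + e • (oneSub y * oneSub z)
        ∈ augIdeal p ^ 3 := by
  have h2 : det₂ y z • oneSub x + det₂ z x • oneSub y + det₂ x y • oneSub z ∈ augIdeal p ^ 2 := by
    have h1 := oneSub_smul_sub_mem (det₂ y z) x
    have h2 := oneSub_smul_sub_mem (det₂ z x) y
    have h3 := oneSub_smul_sub_mem (det₂ x y) z
    have h4 : oneSub (det₂ y z • x) * oneSub (det₂ z x • y) ∈ augIdeal p ^ 2 := by
      rw [sq]
      exact Ideal.mul_mem_mul (oneSub_mem _) (oneSub_mem _)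
    have h5 : oneSub (det₂ y z • x + det₂ z x • y) * oneSub (det₂ x y • z) ∈ augIdeal p ^ 2 := by
      rw [sq]
      exact Ideal.mul_mem_mul (oneSub_mem _) (oneSub_mem _)
    have h6 : oneSub (det₂ y z • x + det₂ z x • y + det₂ x y • z) = 0 := by
      rw [← oneSub_zero]
      congr 1
      ext <;> simp [det₂] <;> ring
    rw [oneSub_add, oneSub_add] at h6
    rw [oneSub_add] at h5
    have := sub_mem (add_mem h4 h5) (add_mem (add_mem h1 h2) h3)
    convert this using 1
    linear_combination h6
  obtain ⟨c, d, e, h⟩ := exists_sub_mem_cube hxy hyz hzx h2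
  refine ⟨-c, -d, -e, ?_⟩
  convert h using 1
  simp only [neg_smul]
  abel

/-- A linear relation between two parallel vectors lifts to a relation in `I ^ 3`. -/
theorem exists_relation_of_parallel {x z : ZMod p × ZMod p} {c : ZMod p} (hc : c ≠ 0)
    (hz : z = c • x) :
    ∃ d : ZMod p, (-c) • oneSub x + oneSub z + d • (oneSub x * oneSub z) ∈ augIdeal p ^ 3 := by
  obtain ⟨t, ht⟩ := oneSub_smul c x
  rw [← hz] at ht
  obtain ⟨k, hk⟩ := exists_sub_mem_augIdeal t
  refine ⟨-(k / c), ?_⟩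
  have hx := oneSub_mem x
  have hcc : algebraMap (ZMod p) (Alg p) (k / c) * algebraMap (ZMod p) (Alg p) c
      = algebraMap _ _ k := by
    rw [← map_mul, div_mul_cancel₀ _ hc]
  have : (-c) • oneSub x + oneSub z + (-(k / c)) • (oneSub x * oneSub z)
      = oneSub x ^ 2 * (t - algebraMap _ _ k)
        - oneSub x ^ 3 * (algebraMap _ _ (k / c) * t) := by
    rw [ht]
    simp only [Algebra.smul_def, map_neg]
    linear_combination (-(oneSub x ^ 2)) * hcc
  rw [this]
  refine sub_mem ?_ (Ideal.mul_mem_right _ _ (Ideal.pow_mem_pow hx 3))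
  rw [pow_succ (augIdeal p) 2]
  exact Ideal.mul_mem_mul (Ideal.pow_mem_pow hx 2) hk

end PlaneAlgebra

/-! ### Unique zero sums in an elementary abelian group of rank two -/

/-- The terms indexed by `U` form a minimal zero-sum subfamily. -/
def IsBlock {ι G : Type*} [AddCommGroup G] (f : ι → G) (U : Finset ι) : Prop :=
  U.Nonempty ∧ ∑ i ∈ U, f i = 0 ∧ ∀ T ⊆ U, T.Nonempty → ∑ i ∈ T, f i = 0 → T = U

theorem exists_isBlock_subset {ι G : Type*} [AddCommGroup G] {f : ι → G} {Y : Finset ι}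
    (hY : Y.Nonempty) (h0 : ∑ i ∈ Y, f i = 0) : ∃ U ⊆ Y, IsBlock f U := by
  induction Y using Finset.strongInduction with
  | H Y ih =>
    by_cases h : ∃ T ⊂ Y, T.Nonempty ∧ ∑ i ∈ T, f i = 0
    · obtain ⟨T, hT, hT1, hT2⟩ := h
      obtain ⟨U, hU, hU'⟩ := ih T hT hT1 hT2
      exact ⟨U, hU.trans hT.subset, hU'⟩
    · refine ⟨Y, subset_rfl, hY, h0, fun T hT hT1 hT2 => ?_⟩
      by_contra hne
      exact h ⟨T, Finset.ssubset_iff_subset_ne.2 ⟨hT, hne⟩, hT1, hT2⟩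

namespace PlaneAlgebra

open AddMonoidAlgebra

variable {p : ℕ} {ι : Type*} [DecidableEq ι]

/-- The product of the elements `1 - X ^ f i` for `i ∈ F`. -/
noncomputable def prodOneSub (f : ι → ZMod p × ZMod p) (F : Finset ι) : Alg p :=
  ∏ i ∈ F, oneSub (f i)

/-- The elements of the group algebra supported on the subset sums of `f` over `Y`. -/
noncomputable def sumSpan (f : ι → ZMod p × ZMod p) (Y : Finset ι) : Submodule (ZMod p) (Alg p) :=
  Submodule.span (ZMod p) {θ | ∃ D ⊆ Y, θ = single (∑ i ∈ D, f i) 1}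

/-- Some element of the `o`-th power of the augmentation ideal is supported on the subset sums
of `f` over `Y` and has nonzero coefficient at the neutral element. -/
def HasOrder (f : ι → ZMod p × ZMod p) (Y : Finset ι) (o : ℕ) : Prop :=
  ∃ θ ∈ augIdeal p ^ o, θ ∈ sumSpan f Y ∧ coeffZero p θ ≠ 0

variable {f : ι → ZMod p × ZMod p} {s Y Y' F U U' : Finset ι} {o o' : ℕ}

theorem prodOneSub_eq (f : ι → ZMod p × ZMod p) (F : Finset ι) :
    prodOneSub f F = ∑ T ∈ F.powerset, (-1 : ZMod p) ^ T.card • single (∑ i ∈ T, f i) 1 := by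
  have hs : ∀ T : Finset ι, (single (∑ i ∈ T, f i) 1 : Alg p) = ∏ i ∈ T, single (f i) 1 := by
    intro T
    induction T using Finset.induction_on with
    | empty => simp [one_def]
    | insert a T ha ih => rw [Finset.sum_insert ha, Finset.prod_insert ha, ← ih,
        single_mul_single, one_mul]
  simp only [prodOneSub, oneSub]
  rw [Finset.prod_sub]
  refine Finset.sum_congr rfl fun T _ => ?_
  rw [hs, Algebra.smul_def, map_pow, map_neg, map_one]
  simp

theorem prodOneSub_mem_sumSpan (hF : F ⊆ Y) : prodOneSub f F ∈ sumSpan f Y := by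
  rw [prodOneSub_eq]
  refine Submodule.sum_mem _ fun T hT => Submodule.smul_mem _ _ (Submodule.subset_span ?_)
  exact ⟨T, (Finset.mem_powerset.1 hT).trans hF, rfl⟩

omit [DecidableEq ι] in
theorem prodOneSub_mem_pow (f : ι → ZMod p × ZMod p) (F : Finset ι) :
    prodOneSub f F ∈ augIdeal p ^ F.card := by
  rw [prodOneSub, Finset.card_eq_sum_ones, ← Finset.prod_pow_eq_pow_sum]
  exact Ideal.prod_mem_prod fun i _ => by rw [pow_one]; exact oneSub_mem _

theorem prodOneSub_erase_mul {i : ι} (hi : i ∈ F) :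
    prodOneSub f (F.erase i) * oneSub (f i) = prodOneSub f F :=
  Finset.prod_erase_mul _ _ hi

theorem coeffZero_prodOneSub_of_ssubset (hU : IsBlock f U) (hF : F ⊂ U) :
    coeffZero p (prodOneSub f F) = 1 := by
  rw [prodOneSub_eq, map_sum, Finset.sum_eq_single_of_mem ∅ (Finset.empty_mem_powerset F)]
  · simp [coeffZero_single]
  · intro T hT hT0
    rw [map_smul, coeffZero_single, if_neg, smul_zero]
    intro h0
    rw [Finset.mem_powerset] at hT
    have := hU.2.2 T (hT.trans hF.subset) (Finset.nonempty_iff_ne_empty.2 hT0) h0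
    exact hF.not_subset (this ▸ hT)

theorem coeffZero_prodOneSub (hU : IsBlock f U) :
    coeffZero p (prodOneSub f U) = 1 + (-1) ^ U.card := by
  rw [prodOneSub_eq, map_sum, Finset.sum_eq_add (a := ∅) (b := U) hU.1.ne_empty.symm]
  · rw [map_smul, map_smul, hU.2.1, Finset.sum_empty, coeffZero_single]
    simp
  · intro T hT hT0
    rw [map_smul, coeffZero_single, if_neg, smul_zero]
    intro h0
    exact hT0.2 (hU.2.2 T (Finset.mem_powerset.1 hT) (Finset.nonempty_iff_ne_empty.2 hT0.1) h0)
  · simp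
  · simp

theorem mul_mem_sumSpan (hd : Disjoint Y Y') {θ θ' : Alg p} (hθ : θ ∈ sumSpan f Y)
    (hθ' : θ' ∈ sumSpan f Y') : θ * θ' ∈ sumSpan f (Y ∪ Y') := by
  have := Submodule.mul_mem_mul hθ hθ'
  rw [sumSpan, sumSpan, Submodule.span_mul_span] at this
  refine Submodule.span_mono ?_ this
  rintro _ ⟨_, ⟨D, hD, rfl⟩, _, ⟨D', hD', rfl⟩, rfl⟩
  refine ⟨D ∪ D', Finset.union_subset_union hD hD', ?_⟩
  simp only [single_mul_single, one_mul]
  rw [Finset.sum_union (Finset.disjoint_of_subset_left hD (Finset.disjoint_of_subset_right hD' hd))]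

/-- If `Y` is zero-sum and disjoint from `Y'`, a zero sum over `Y ∪ Y'` splits into zero sums over
`Y` and `Y'`; so coefficients at the neutral element multiply. -/
theorem coeffZero_mul (hs : UniqueZeroSums s f) (hY : Y ⊆ s) (hY' : Y' ⊆ s) (hd : Disjoint Y Y')
    (h0 : ∑ i ∈ Y, f i = 0) {θ θ' : Alg p} (hθ : θ ∈ sumSpan f Y)
    (hθ' : θ' ∈ sumSpan f Y') : coeffZero p (θ * θ') = coeffZero p θ * coeffZero p θ' := by
  induction hθ, hθ' using Submodule.span_induction₂ with
  | mem_mem x y hx hy =>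
    obtain ⟨D, hD, rfl⟩ := hx
    obtain ⟨D', hD', rfl⟩ := hy
    have hdD : Disjoint D D' :=
      Finset.disjoint_of_subset_left hD (Finset.disjoint_of_subset_right hD' hd)
    rw [single_mul_single, one_mul, coeffZero_single, coeffZero_single, coeffZero_single]
    have key : ∑ i ∈ D, f i + ∑ i ∈ D', f i = 0 → ∑ i ∈ D, f i = 0 := by
      intro h
      rw [← Finset.sum_union hdD] at h
      have h1 := hs _ (Finset.union_subset (hD.trans hY) (hD'.trans hY')) Y hY h h0
      have h2 : (D ∪ D') ∩ Y = D := by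
        rw [Finset.union_inter_distrib_right, Finset.inter_eq_left.2 hD,
          Finset.disjoint_iff_inter_eq_empty.1 ((Finset.disjoint_of_subset_right hD' hd).symm),
          Finset.union_empty]
      rwa [h2] at h1
    by_cases h1 : ∑ i ∈ D, f i = 0
    · simp [h1]
    · rw [if_neg fun h => h1 (key h), if_neg h1, zero_mul]
  | zero_left y _ => simp
  | zero_right x _ => simp
  | add_left x y z _ _ _ h1 h2 => rw [add_mul, map_add, map_add, h1, h2, add_mul]
  | add_right x y z _ _ _ h1 h2 => rw [mul_add, map_add, map_add, h1, h2, mul_add]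
  | smul_left r x y _ _ h => rw [smul_mul_assoc, map_smul, map_smul, h, smul_mul_assoc]
  | smul_right r x y _ _ h => rw [mul_smul_comm, map_smul, map_smul, h, mul_smul_comm]

theorem HasOrder.union [Fact p.Prime] (hs : UniqueZeroSums s f) (hY : Y ⊆ s) (hY' : Y' ⊆ s)
    (hd : Disjoint Y Y') (h0 : ∑ i ∈ Y, f i = 0) (h : HasOrder f Y o) (h' : HasOrder f Y' o') :
    HasOrder f (Y ∪ Y') (o + o') := by
  obtain ⟨θ, h1, h2, h3⟩ := h
  obtain ⟨θ', h1', h2', h3'⟩ := h'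
  refine ⟨θ * θ', ?_, mul_mem_sumSpan hd h2 h2', ?_⟩
  · rw [pow_add]
    exact Ideal.mul_mem_mul h1 h1'
  · rw [coeffZero_mul hs hY hY' hd h0 h2 h2']
    exact mul_ne_zero h3 h3'

omit [DecidableEq ι] in
theorem HasOrder.le [Fact p.Prime] (h : HasOrder f Y o) : o ≤ 2 * p - 2 := by
  obtain ⟨θ, h1, -, h3⟩ := h
  by_contra! ho
  have : θ ∈ augIdeal p ^ (2 * p - 1) := Ideal.pow_le_pow_right (by omega) h1
  rw [augIdeal_pow_eq_bot, Submodule.mem_bot] at this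
  exact h3 (by rw [this, map_zero])

theorem hasOrder_empty [Fact p.Prime] : HasOrder f ∅ 0 := by
  refine ⟨prodOneSub f ∅, prodOneSub_mem_pow f ∅, prodOneSub_mem_sumSpan subset_rfl, ?_⟩
  rw [prodOneSub, Finset.prod_empty, one_def, coeffZero_single]
  simp

/-- Leaving out one factor `1 - X ^ f i` avoids the cancellation between the empty sum and the sum
of the whole block. -/
theorem hasOrder_erase [Fact p.Prime] (hU : IsBlock f U) : HasOrder f U (U.card - 1) := by
  obtain ⟨i, hi⟩ := hU.1
  refine ⟨prodOneSub f (U.erase i), ?_, prodOneSub_mem_sumSpan (Finset.erase_subset _ _), ?_⟩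
  · rw [← Finset.card_erase_of_mem hi]
    exact prodOneSub_mem_pow _ _
  · rw [coeffZero_prodOneSub_of_ssubset hU (Finset.erase_ssubset hi)]
    exact one_ne_zero

theorem hasOrder_of_parity (hU : IsBlock f U) (h : (1 + (-1) ^ U.card : ZMod p) ≠ 0) :
    HasOrder f U U.card :=
  ⟨prodOneSub f U, prodOneSub_mem_pow f U, prodOneSub_mem_sumSpan subset_rfl, by
    rwa [coeffZero_prodOneSub hU]⟩

/-- For `f j = c • f i` with `c ≠ 1`, replacing one of the two factors `1 - X ^ f i`,
`1 - X ^ f j` by the relation `(1 - X ^ f j) - c • (1 - X ^ f i) ∈ I ^ 2` saves one. -/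
theorem hasOrder_of_parallel [Fact p.Prime] (hU : IsBlock f U) {i j : ι} (hi : i ∈ U) (hj : j ∈ U)
    (hne : i ≠ j) {c : ZMod p} (hc : c ≠ 1) (hij : f j = c • f i) : HasOrder f U U.card := by
  have hj' : j ∈ U.erase i := Finset.mem_erase.2 ⟨hne.symm, hj⟩
  have hi' : i ∈ U.erase j := Finset.mem_erase.2 ⟨hne, hi⟩
  have h1 : prodOneSub f ((U.erase i).erase j) * (oneSub (f j) - c • oneSub (f i))
      = prodOneSub f (U.erase i) - c • prodOneSub f (U.erase j) := by
    rw [mul_sub, mul_smul_comm, prodOneSub_erase_mul hj', Finset.erase_right_comm,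
      prodOneSub_erase_mul hi']
  refine ⟨prodOneSub f (U.erase i) - c • prodOneSub f (U.erase j), ?_, ?_, ?_⟩
  · have hcard : U.card = ((U.erase i).erase j).card + 2 := by
      rw [Finset.card_erase_of_mem hj', Finset.card_erase_of_mem hi]
      have := Finset.one_lt_card.2 ⟨i, hi, j, hj, hne⟩
      omega
    rw [← h1, hcard, pow_add]
    refine Ideal.mul_mem_mul (prodOneSub_mem_pow _ _) ?_
    rw [hij]
    exact oneSub_smul_sub_mem c (f i)
  · exact sub_mem (prodOneSub_mem_sumSpan (Finset.erase_subset _ _))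
      (Submodule.smul_mem _ _ (prodOneSub_mem_sumSpan (Finset.erase_subset _ _)))
  · rw [map_sub, map_smul, coeffZero_prodOneSub_of_ssubset hU (Finset.erase_ssubset hi),
      coeffZero_prodOneSub_of_ssubset hU (Finset.erase_ssubset hj), smul_eq_mul, mul_one]
    exact sub_ne_zero.2 hc.symm

/-- A relation in `I ^ 3` between one term of `U` and two terms of `U'` lets the union of two
blocks reach the full order, although neither block need do so. -/
theorem hasOrder_union_of_relation [Fact p.Prime] (hs : UniqueZeroSums s f) (hUs : U ⊆ s)
    (hUs' : U' ⊆ s) (hd : Disjoint U U') (hU : IsBlock f U) (hU' : IsBlock f U')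
    (hpar : (1 + (-1) ^ U.card : ZMod p) = 0) (hpar' : (1 + (-1) ^ U'.card : ZMod p) = 0)
    {w x y z : ι} (hw : w ∈ U) (hx : x ∈ U) (hwx : w ≠ x) (hy : y ∈ U') (hz : z ∈ U')
    (hyz : y ≠ z) {α β γ c d e : ZMod p} (hβγ : β + γ ≠ 0)
    (hrel : α • oneSub (f x) + β • oneSub (f y) + γ • oneSub (f z)
      + c • (oneSub (f x) * oneSub (f y)) + d • (oneSub (f x) * oneSub (f z))
      + e • (oneSub (f y) * oneSub (f z)) ∈ augIdeal p ^ 3) :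
    HasOrder f (U ∪ U') (U.card + U'.card) := by
  have hwx' : w ∈ U.erase x := Finset.mem_erase.2 ⟨hwx, hw⟩
  have hyz' : y ∈ U'.erase z := Finset.mem_erase.2 ⟨hyz, hy⟩
  have hzy' : z ∈ U'.erase y := Finset.mem_erase.2 ⟨hyz.symm, hz⟩
  set A := prodOneSub f ((U.erase x).erase w)
  set B := prodOneSub f ((U'.erase z).erase y) with hB
  have hA1 : A * oneSub (f w) = prodOneSub f (U.erase x) := prodOneSub_erase_mul hwx'
  have hA2 : prodOneSub f (U.erase x) * oneSub (f x) = prodOneSub f U := prodOneSub_erase_mul hx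
  have hB1 : B * oneSub (f y) = prodOneSub f (U'.erase z) := prodOneSub_erase_mul hyz'
  have hB2 : B * oneSub (f z) = prodOneSub f (U'.erase y) := by
    rw [hB, Finset.erase_right_comm]
    exact prodOneSub_erase_mul hzy'
  have hB3 : prodOneSub f (U'.erase z) * oneSub (f z) = prodOneSub f U' := prodOneSub_erase_mul hz
  -- the relation times `A * B * (1 - X ^ f w)` is a combination of products over subsets of `U`
  -- and `U'`; only the two terms in which both subsets are proper have a nonzero coefficient
  -- at the neutral element
  have hexp : A * B * (oneSub (f w) * (α • oneSub (f x) + β • oneSub (f y) + γ • oneSub (f z)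
      + c • (oneSub (f x) * oneSub (f y)) + d • (oneSub (f x) * oneSub (f z))
      + e • (oneSub (f y) * oneSub (f z))))
      = α • (prodOneSub f U * B)
        + β • (prodOneSub f (U.erase x) * prodOneSub f (U'.erase z))
        + γ • (prodOneSub f (U.erase x) * prodOneSub f (U'.erase y))
        + c • (prodOneSub f U * prodOneSub f (U'.erase z))
        + d • (prodOneSub f U * prodOneSub f (U'.erase y))
        + e • (prodOneSub f (U.erase x) * prodOneSub f U') := by
    rw [← hB3, ← hB2, ← hB1, ← hA2, ← hA1]
    simp only [Algebra.smul_def]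
    ring
  have hmem : ∀ F F', F ⊆ U → F' ⊆ U' → prodOneSub f F * prodOneSub f F' ∈ sumSpan f (U ∪ U') :=
    fun F F' h h' => mul_mem_sumSpan hd (prodOneSub_mem_sumSpan h) (prodOneSub_mem_sumSpan h')
  have hco : ∀ F F', F ⊆ U → F' ⊆ U' → coeffZero p (prodOneSub f F * prodOneSub f F')
      = coeffZero p (prodOneSub f F) * coeffZero p (prodOneSub f F') := fun F F' h h' =>
    coeffZero_mul hs hUs hUs' hd hU.2.1 (prodOneSub_mem_sumSpan h) (prodOneSub_mem_sumSpan h')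
  have e1 : U.erase x ⊆ U := Finset.erase_subset _ _
  have e2 : U'.erase y ⊆ U' := Finset.erase_subset _ _
  have e3 : U'.erase z ⊆ U' := Finset.erase_subset _ _
  have e4 : (U'.erase z).erase y ⊆ U' := (Finset.erase_subset _ _).trans e3
  refine ⟨A * B * (oneSub (f w) * (α • oneSub (f x) + β • oneSub (f y) + γ • oneSub (f z)
      + c • (oneSub (f x) * oneSub (f y)) + d • (oneSub (f x) * oneSub (f z))
      + e • (oneSub (f y) * oneSub (f z)))), ?_, ?_, ?_⟩
  rotate_left
  · rw [hexp]
    refine add_mem (add_mem (add_mem (add_mem (add_mem ?_ ?_) ?_) ?_) ?_) ?_ <;>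
      exact Submodule.smul_mem _ _ (hmem _ _ (by first | exact subset_rfl | assumption)
        (by first | exact subset_rfl | assumption))
  · rw [hexp]
    simp only [map_add, map_smul, hB]
    rw [hco _ _ subset_rfl e4, hco _ _ e1 e3, hco _ _ e1 e2, hco _ _ subset_rfl e3,
      hco _ _ subset_rfl e2, hco _ _ e1 subset_rfl, coeffZero_prodOneSub hU,
      coeffZero_prodOneSub hU', hpar, hpar',
      coeffZero_prodOneSub_of_ssubset hU (Finset.erase_ssubset hx),
      coeffZero_prodOneSub_of_ssubset hU' (Finset.erase_ssubset hy),
      coeffZero_prodOneSub_of_ssubset hU' (Finset.erase_ssubset hz)]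
    simpa using hβγ
  · have h1 : U.card = ((U.erase x).erase w).card + 2 := by
      rw [Finset.card_erase_of_mem hwx', Finset.card_erase_of_mem hx]
      have := Finset.one_lt_card.2 ⟨w, hw, x, hx, hwx⟩
      omega
    have h2 : U'.card = ((U'.erase z).erase y).card + 2 := by
      rw [Finset.card_erase_of_mem hyz', Finset.card_erase_of_mem hz]
      have := Finset.one_lt_card.2 ⟨y, hy, z, hz, hyz⟩
      omega
    have h3 : U.card + U'.card
        = ((U.erase x).erase w).card + ((U'.erase z).erase y).card + (1 + 3) := by omega
    rw [h3, pow_add, pow_add, pow_add _ 1 3, pow_one]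
    exact Ideal.mul_mem_mul (Ideal.mul_mem_mul (prodOneSub_mem_pow _ _) (prodOneSub_mem_pow _ _))
      (Ideal.mul_mem_mul (oneSub_mem _) hrel)

end PlaneAlgebra

section

variable {p : ℕ} [Fact p.Prime]

theorem exists_eq_smul_of_det₂_eq_zero {v w : ZMod p × ZMod p} (hv : v ≠ 0) (h : det₂ v w = 0) :
    ∃ c : ZMod p, w = c • v := by
  simp only [det₂] at h
  by_cases h1 : v.1 = 0
  · have h2 : v.2 ≠ 0 := fun h2 => hv (Prod.ext h1 h2)
    refine ⟨w.2 / v.2, Prod.ext ?_ ?_⟩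
    · simpa [h1, h2] using h
    · simp [h2]
  · refine ⟨w.1 / v.1, Prod.ext ?_ ?_⟩
    · simp [h1]
    · simp only [Prod.smul_snd, smul_eq_mul]
      field_simp
      linear_combination h

theorem det₂_eq_zero_of_common {u u' w : ZMod p × ZMod p} (hw : w ≠ 0) (h : det₂ u w = 0)
    (h' : det₂ u' w = 0) : det₂ u u' = 0 := by
  have h1 : det₂ w u = 0 := by simp only [det₂] at h ⊢; linear_combination -h
  have h2 : det₂ w u' = 0 := by simp only [det₂] at h' ⊢; linear_combination -h'
  obtain ⟨c, rfl⟩ := exists_eq_smul_of_det₂_eq_zero hw h1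
  obtain ⟨d, rfl⟩ := exists_eq_smul_of_det₂_eq_zero hw h2
  simp only [det₂, Prod.smul_fst, Prod.smul_snd, smul_eq_mul]
  ring

variable {ι : Type*} [DecidableEq ι] {s U U' Y : Finset ι} {f : ι → ZMod p × ZMod p}

/-- A constant block has all multiples of its value as subset sums, so the terms outside its line
have unique zero sums modulo the line. -/
theorem UniqueZeroSums.card_le_of_isBlock_const (h : UniqueZeroSums s f) (hf : ∀ i ∈ s, f i ≠ 0)
    (hUs : U ⊆ s) (hU : IsBlock f U) {v : ZMod p × ZMod p} (hv : ∀ i ∈ U, f i = v) :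
    s.card ≤ 2 * p := by
  obtain ⟨i₀, hi₀⟩ := hU.1
  have hv0 : v ≠ 0 := hv i₀ hi₀ ▸ hf i₀ (hUs hi₀)
  have hUp : p ≤ U.card := by
    have h1 : (U.card : ZMod p) • v = 0 := by
      rw [Nat.cast_smul_eq_nsmul, ← Finset.sum_const, ← Finset.sum_congr rfl hv, hU.2.1]
    have h2 : (U.card : ZMod p) = 0 := (smul_eq_zero.1 h1).resolve_right hv0
    exact Nat.le_of_dvd (Finset.card_pos.2 hU.1) ((ZMod.natCast_eq_zero_iff _ _).1 h2)
  have hcov : ∀ c : ZMod p, ∃ T ⊆ U, ∑ i ∈ T, f i = c • v := by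
    intro c
    obtain ⟨T, hT, hTc⟩ := Finset.exists_subset_card_eq ((ZMod.val_lt c).le.trans hUp)
    refine ⟨T, hT, ?_⟩
    rw [Finset.sum_congr rfl fun i hi => hv i (hT hi), Finset.sum_const, hTc,
      ← Nat.cast_smul_eq_nsmul (ZMod p), ZMod.natCast_zmod_val]
  let φ : ZMod p × ZMod p →+ ZMod p := AddMonoidHom.mk' (fun w => det₂ v w) fun a b => by
    simp only [det₂, Prod.fst_add, Prod.snd_add]
    ring
  have hφU : ∀ i ∈ U, φ (f i) = 0 := fun i hi => by
    change det₂ v (f i) = 0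
    rw [hv i hi, det₂]
    ring
  have h1 : (s.filter fun i => φ (f i) ≠ 0).card ≤ p := by
    have hU' : s.filter (fun i => φ (f i) ≠ 0) = (U ∪ s.filter fun i => φ (f i) ≠ 0) \ U := by
      ext i
      simp only [Finset.mem_filter, Finset.mem_sdiff, Finset.mem_union]
      have := hφU i
      tauto
    have h2 : UniqueZeroSums ((U ∪ s.filter fun i => φ (f i) ≠ 0) \ U) fun i => φ (f i) := by
      refine (h.mono (Finset.union_subset hUs (Finset.filter_subset _ _))).map_sdiff
        Finset.subset_union_left φ hφU fun T _ hT0 => ?_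
      obtain ⟨c, hc⟩ := exists_eq_smul_of_det₂_eq_zero hv0 hT0
      obtain ⟨Y, hY, hYc⟩ := hcov (-c)
      exact ⟨Y, hY, by rw [hYc, hc, neg_smul]⟩
    rw [← hU'] at h2
    exact h2.card_le_of_prime fun i hi => (Finset.mem_filter.1 hi).2
  have h3 : (s.filter fun i => φ (f i) = 0).card ≤ p := by
    have hc : ∀ i, ∃ c : ZMod p, φ (f i) = 0 → f i = c • v := by
      intro i
      by_cases hi : φ (f i) = 0
      · obtain ⟨c, hc⟩ := exists_eq_smul_of_det₂_eq_zero hv0 hi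
        exact ⟨c, fun _ => hc⟩
      · exact ⟨0, fun h => absurd h hi⟩
    choose c hc using hc
    have h4 : UniqueZeroSums (s.filter fun i => φ (f i) = 0) c := by
      refine (h.mono (Finset.filter_subset _ _)).congr fun A hA => ?_
      rw [Finset.sum_congr rfl fun i hi => hc i (Finset.mem_filter.1 (hA hi)).2,
        ← Finset.sum_smul, smul_eq_zero_iff_left hv0]
    refine h4.card_le_of_prime fun i hi hci => ?_
    rw [Finset.mem_filter] at hi
    exact hf i hi.1 (by rw [hc i hi.2, hci, zero_smul])
  have := Finset.card_filter_add_card_filter_not (s := s) fun i => φ (f i) = 0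
  simp only [ne_eq] at h1
  omega

namespace PlaneAlgebra

/-- The blocks `U` for which the product of all `1 - X ^ f i` has vanishing coefficient at the
neutral element, and whose terms do not all lie on one line. On their own they are only known to
have the order `U.card - 1`. -/
def IsLossy (f : ι → ZMod p × ZMod p) (U : Finset ι) : Prop :=
  IsBlock f U ∧ (1 + (-1) ^ U.card : ZMod p) = 0 ∧ ∃ i ∈ U, ∃ j ∈ U, det₂ (f i) (f j) ≠ 0

theorem hasOrder_or_isLossy (hf : ∀ i ∈ U, f i ≠ 0) (hU : IsBlock f U)
    (hconst : ∃ i ∈ U, ∃ j ∈ U, f i ≠ f j) : HasOrder f U U.card ∨ IsLossy f U := by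
  by_cases h1 : (1 + (-1) ^ U.card : ZMod p) = 0
  · by_cases h2 : ∃ i ∈ U, ∃ j ∈ U, det₂ (f i) (f j) ≠ 0
    · exact Or.inr ⟨hU, h1, h2⟩
    · left
      push Not at h2
      obtain ⟨i, hi, j, hj, hij⟩ := hconst
      obtain ⟨c, hc⟩ := exists_eq_smul_of_det₂_eq_zero (hf i hi) (h2 i hi j hj)
      refine hasOrder_of_parallel hU hi hj (fun h => hij (h ▸ rfl)) (c := c) ?_ hc
      rintro rfl
      exact hij (by rw [hc, one_smul])
  · exact Or.inl (hasOrder_of_parity hU h1)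

/-- Two lossy blocks together reach the full order, by a relation between one term of the first and
two terms of the second block. -/
theorem hasOrder_union_of_isLossy (hs : UniqueZeroSums s f) (hf : ∀ i ∈ s, f i ≠ 0)
    (hUs : U ⊆ s) (hUs' : U' ⊆ s) (hd : Disjoint U U') (hU : IsLossy f U) (hU' : IsLossy f U') :
    HasOrder f (U ∪ U') (U.card + U'.card) := by
  obtain ⟨hUb, hpar, u, hu, u', hu', huu'⟩ := hU
  obtain ⟨hUb', hpar', y, hy, z, hz, hyz⟩ := hU'
  have hdet : ∀ i : ι, det₂ (f i) (f i) = 0 := fun i => by simp only [det₂]; ring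
  have hyz' : y ≠ z := fun h => hyz (h ▸ hdet y)
  have hne : ∀ x : ι, ∃ w ∈ U, w ≠ x := fun x => Finset.exists_mem_ne
    (Finset.one_lt_card.2 ⟨u, hu, u', hu', fun h => huu' (h ▸ hdet u)⟩) x
  have hparallel : ∀ x ∈ U, ∀ y ∈ U', ∀ z ∈ U', z ≠ y → det₂ (f x) (f y) = 0 →
      HasOrder f (U ∪ U') (U.card + U'.card) := by
    intro x hx y hy z hz hzy hxy
    obtain ⟨w, hw, hwx⟩ := hne x
    obtain ⟨c, hc⟩ := exists_eq_smul_of_det₂_eq_zero (hf x (hUs hx)) hxy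
    have hc0 : c ≠ 0 := by
      rintro rfl
      exact hf y (hUs' hy) (by rw [hc, zero_smul])
    obtain ⟨d, hd'⟩ := exists_relation_of_parallel hc0 hc
    refine hasOrder_union_of_relation hs hUs hUs' hd hUb hUb' hpar hpar' hw hx hwx hz hy hzy
      (α := -c) (β := 0) (γ := 1) (c := 0) (d := d) (e := 0) (by simp) ?_
    simpa using hd'
  by_cases h1 : ∃ x ∈ U, det₂ (f x) (f y) = 0
  · obtain ⟨x, hx, hxy⟩ := h1
    exact hparallel x hx y hy z hz hyz'.symm hxy
  by_cases h2 : ∃ x ∈ U, det₂ (f x) (f z) = 0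
  · obtain ⟨x, hx, hxz⟩ := h2
    exact hparallel x hx z hz y hy hyz' hxz
  push Not at h1 h2
  have hsub : f y - f z ≠ 0 := fun h => hyz (by rw [sub_eq_zero.1 h]; exact hdet z)
  obtain ⟨x, hx, hx0⟩ : ∃ x ∈ U, det₂ (f x) (f y - f z) ≠ 0 := by
    by_contra! h
    exact huu' (det₂_eq_zero_of_common hsub (h u hu) (h u' hu'))
  obtain ⟨w, hw, hwx⟩ := hne x
  obtain ⟨c, d, e, hrel⟩ := exists_relation_of_det_ne_zero (h1 x hx) hyz
    (fun h => h2 x hx (by simp only [det₂] at h ⊢; linear_combination -h))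
  refine hasOrder_union_of_relation hs hUs hUs' hd hUb hUb' hpar hpar' hw hx hwx hy hz hyz' ?_ hrel
  intro h
  apply hx0
  simp only [det₂, Prod.fst_sub, Prod.snd_sub] at h ⊢
  linear_combination h

/-- Pairing the lossy blocks, at most one of them remains. -/
theorem hasOrder_or_exists_isLossy (hs : UniqueZeroSums s f) (hf : ∀ i ∈ s, f i ≠ 0)
    (hconst : ∀ U ⊆ s, IsBlock f U → ∃ i ∈ U, ∃ j ∈ U, f i ≠ f j) (hY : Y ⊆ s)
    (h0 : ∑ i ∈ Y, f i = 0) :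
    HasOrder f Y Y.card ∨ ∃ U ⊆ Y, IsLossy f U ∧ HasOrder f (Y \ U) (Y \ U).card := by
  induction Y using Finset.strongInduction with
  | H Y ih =>
    rcases Y.eq_empty_or_nonempty with rfl | hne
    · exact Or.inl hasOrder_empty
    obtain ⟨U, hUY, hU⟩ := exists_isBlock_subset hne h0
    have hUs := hUY.trans hY
    have hdiff : ∀ T ⊆ Y, IsBlock f T → ∑ i ∈ Y \ T, f i = 0 := fun T hT hTb => by
      have := Finset.sum_sdiff hT (f := f)
      rwa [hTb.2.1, add_zero, h0] at this
    have ih := ih (Y \ U) (Finset.sdiff_ssubset hUY hU.1) (Finset.sdiff_subset.trans hY)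
      (hdiff U hUY hU)
    have hunion : U ∪ Y \ U = Y := Finset.union_sdiff_of_subset hUY
    rcases hasOrder_or_isLossy (fun i hi => hf i (hUs hi)) hU (hconst U hUs hU) with hUo | hUl
    · rcases ih with ih | ⟨U', hU'Y, hU'l, hU'o⟩
      · left
        have := hUo.union hs hUs (Finset.sdiff_subset.trans hY) Finset.disjoint_sdiff hU.2.1 ih
        rwa [hunion, ← Finset.card_union_of_disjoint Finset.disjoint_sdiff, hunion] at this
      · right
        refine ⟨U', hU'Y.trans Finset.sdiff_subset, hU'l, ?_⟩
        have hd : Disjoint U ((Y \ U) \ U') :=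
          Finset.disjoint_of_subset_right Finset.sdiff_subset Finset.disjoint_sdiff
        have := hUo.union hs hUs ((Finset.sdiff_subset.trans Finset.sdiff_subset).trans hY) hd
          hU.2.1 hU'o
        have he : U ∪ (Y \ U) \ U' = Y \ U' := by
          ext i
          have h1 := @hUY i
          have h2 := @hU'Y i
          simp only [Finset.mem_sdiff, Finset.mem_union] at h2 ⊢
          tauto
        rwa [← Finset.card_union_of_disjoint hd, he] at this
    · rcases ih with ih | ⟨U', hU'Y, hU'l, hU'o⟩
      · exact Or.inr ⟨U, hUY, hUl, ih⟩
      · left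
        have hU's : U' ⊆ s := hU'Y.trans (Finset.sdiff_subset.trans hY)
        have hd : Disjoint U U' := Finset.disjoint_of_subset_right hU'Y Finset.disjoint_sdiff
        have h1 := hasOrder_union_of_isLossy hs hf hUs hU's hd hUl hU'l
        have h2 : ∑ i ∈ U ∪ U', f i = 0 := by
          rw [Finset.sum_union hd, hU.2.1, hU'l.1.2.1, add_zero]
        have he : (Y \ U) \ U' = Y \ (U ∪ U') := by
          rw [Finset.sdiff_sdiff_left']
          ext i
          simp only [Finset.mem_inter, Finset.mem_sdiff, Finset.mem_union]
          tauto
        rw [he] at hU'o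
        have h3 := h1.union hs (Finset.union_subset hUs hU's) (Finset.sdiff_subset.trans hY)
          Finset.disjoint_sdiff h2 hU'o
        have h4 : U ∪ U' ∪ Y \ (U ∪ U') = Y := Finset.union_sdiff_of_subset
          (Finset.union_subset hUY (hU'Y.trans Finset.sdiff_subset))
        rwa [h4, ← Finset.card_union_of_disjoint hd,
          ← Finset.card_union_of_disjoint Finset.disjoint_sdiff, h4] at h3

end PlaneAlgebra

namespace PlaneAlgebra

theorem hasOrder_of_zeroSumFree (h : ∀ T ⊆ F, T.Nonempty → ∑ i ∈ T, f i ≠ 0) :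
    HasOrder f F F.card := by
  refine ⟨prodOneSub f F, prodOneSub_mem_pow f F, prodOneSub_mem_sumSpan subset_rfl, ?_⟩
  rw [prodOneSub_eq, map_sum, Finset.sum_eq_single_of_mem ∅ (Finset.empty_mem_powerset F)]
  · simp [coeffZero_single]
  · intro T hT hT0
    rw [map_smul, coeffZero_single, if_neg, smul_zero]
    exact h T (Finset.mem_powerset.1 hT) (Finset.nonempty_iff_ne_empty.2 hT0)

end PlaneAlgebra

open PlaneAlgebra in
/-- A family of nonzero elements with unique zero sums in an elementary abelian group of rank two
has at most `2 * p` terms: unless some block is constant, the largest zero-sum subfamily has the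
full order up to one lossy block, and the remaining terms have no zero sums at all. -/
theorem UniqueZeroSums.card_le_of_plane (h : UniqueZeroSums s f) (hf : ∀ i ∈ s, f i ≠ 0) :
    s.card ≤ 2 * p := by
  by_cases hconst : ∀ U ⊆ s, IsBlock f U → ∃ i ∈ U, ∃ j ∈ U, f i ≠ f j
  · have hp := (Fact.out : p.Prime).two_le
    obtain ⟨Y, hY, hmax⟩ := (s.powerset.filter fun T => ∑ i ∈ T, f i = 0).exists_max_image
      Finset.card ⟨∅, by simp⟩
    rw [Finset.mem_filter, Finset.mem_powerset] at hY
    obtain ⟨hYs, hY0⟩ := hY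
    have hfree : HasOrder f (s \ Y) (s \ Y).card := by
      refine hasOrder_of_zeroSumFree fun T hT hTne hT0 => ?_
      have hd : Disjoint Y T := Finset.disjoint_of_subset_right hT Finset.disjoint_sdiff
      have h1 := hmax (Y ∪ T) (Finset.mem_filter.2 ⟨Finset.mem_powerset.2
        (Finset.union_subset hYs (hT.trans Finset.sdiff_subset)), by
          rw [Finset.sum_union hd, hY0, hT0, add_zero]⟩)
      rw [Finset.card_union_of_disjoint hd] at h1
      have := Finset.card_pos.2 hTne
      omega
    have hYo : HasOrder f Y Y.card ∨ HasOrder f Y (Y.card - 1) := by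
      rcases hasOrder_or_exists_isLossy h hf hconst hYs hY0 with h1 | ⟨U, hU, hUl, h1⟩
      · exact Or.inl h1
      · right
        have h2 := (hasOrder_erase hUl.1).union h (hU.trans hYs)
          (Finset.sdiff_subset.trans hYs) Finset.disjoint_sdiff hUl.1.2.1 h1
        have h3 := Finset.card_sdiff_add_card_eq_card hU
        have h4 := Finset.card_pos.2 hUl.1.1
        rwa [Finset.union_sdiff_of_subset hU,
          show U.card - 1 + (Y \ U).card = Y.card - 1 by omega] at h2
    have hcard := Finset.card_sdiff_add_card_eq_card hYs
    rcases hYo with hYo | hYo <;>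
    · have := (hYo.union h hYs Finset.sdiff_subset Finset.disjoint_sdiff hY0 hfree).le
      omega
  · push Not at hconst
    obtain ⟨U, hU, hUb, hUc⟩ := hconst
    obtain ⟨i, hi⟩ := hUb.1
    exact h.card_le_of_isBlock_const hf hU hUb fun j hj => hUc j hj i hi

end

/-! ### Cross numbers of families and their bounds -/

section

variable {ι G : Type*} [DecidableEq ι] [AddCommGroup G] {s : Finset ι} {g : ι → G}

/-- The cross number of the family `g` restricted to `s`. -/
noncomputable def cross {ι G : Type*} [AddCommGroup G] (s : Finset ι) (g : ι → G) : ℚ :=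
  ∑ i ∈ s, 1 / (addOrderOf (g i) : ℚ)

/-- The sum `1 + 1 / p + ⋯ + 1 / p ^ (a - 1)`, which is the contribution of a cyclic summand of
order `p ^ a`. -/
def geomSum (p a : ℕ) : ℚ :=
  ∑ j ∈ Finset.range a, 1 / (p : ℚ) ^ j

/-- The number `x` bounds the cross number of every family with unique zero sums of nonzero
elements of `H` whose orders divide `e`. Index types in the lowest universe suffice. -/
def CrossBound {G : Type*} [AddCommGroup G] (H : AddSubgroup G) (e : ℕ) (x : ℚ) : Prop :=
  ∀ (ι : Type) [DecidableEq ι] (s : Finset ι) (g : ι → G), UniqueZeroSums s g →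
    (∀ i ∈ s, g i ∈ H ∧ e • g i = 0) → (∀ i ∈ s, g i ≠ 0) → cross s g ≤ x

/-- Replacing at least two terms by their sum always lowers the cross number. -/
def Reduced {ι G : Type*} [AddCommGroup G] (s : Finset ι) (g : ι → G) : Prop :=
  ∀ T ⊆ s, 2 ≤ T.card → ∑ i ∈ T, g i ≠ 0 → 1 / (addOrderOf (∑ i ∈ T, g i) : ℚ) < cross T g

theorem geomSum_zero (p : ℕ) : geomSum p 0 = 0 := rfl

theorem geomSum_succ {p : ℕ} (a : ℕ) : geomSum p (a + 1) = 1 + geomSum p a / p := by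
  rw [geomSum, Finset.sum_range_succ', add_comm, geomSum, Finset.sum_div]
  congr 1
  · simp
  · refine Finset.sum_congr rfl fun j _ => ?_
    rw [pow_succ, div_div]

theorem geomSum_nonneg (p a : ℕ) : 0 ≤ geomSum p a :=
  Finset.sum_nonneg fun _ _ => by positivity

theorem geomSum_le {p : ℕ} (hp : 2 ≤ p) (a : ℕ) : geomSum p a ≤ p / (p - 1) := by
  have hp' : (2 : ℚ) ≤ p := by exact_mod_cast hp
  have h1 : (0 : ℚ) < p - 1 := by linarith
  induction a with
  | zero => rw [geomSum_zero]; positivity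
  | succ a ih =>
    rw [geomSum_succ]
    have : (p : ℚ) / (p - 1) = 1 + p / (p - 1) / p := by field_simp; ring
    rw [this]
    gcongr

theorem CrossBound.mono {H : AddSubgroup G} {e : ℕ} {x y : ℚ} (h : CrossBound H e x) (hxy : x ≤ y) :
    CrossBound H e y :=
  fun ι _ s g hu hs hne => (h ι s g hu hs hne).trans hxy

theorem crossBound_one (H : AddSubgroup G) : CrossBound H 1 0 := by
  intro ι _ s g _ hs hne
  have : s = ∅ := Finset.eq_empty_of_forall_notMem fun i hi => hne i hi (by simpa using (hs i hi).2)
  simp [this, cross]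

/-- Replacing terms by their sum as long as the cross number does not drop, one may assume the
family to be reduced. -/
theorem crossBound_of_reduced {H : AddSubgroup G} {e : ℕ} {x : ℚ}
    (h : ∀ (ι : Type) [DecidableEq ι] (s : Finset ι) (g : ι → G), UniqueZeroSums s g →
      (∀ i ∈ s, g i ∈ H ∧ e • g i = 0) → (∀ i ∈ s, g i ≠ 0) → Reduced s g → cross s g ≤ x) :
    CrossBound H e x := by
  intro ι _ s
  induction hn : s.card using Nat.strong_induction_on generalizing s with
  | _ n ih =>
    intro g hu hs hne
    by_cases hr : Reduced s g
    · exact h ι s g hu hs hne hr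
    simp only [Reduced, not_forall, not_lt] at hr
    obtain ⟨T, hT, hT2, hT0, hle⟩ := hr
    obtain ⟨i₀, hi₀⟩ : T.Nonempty := Finset.card_pos.1 (by omega)
    have hni : i₀ ∉ s \ T := fun hi => (Finset.mem_sdiff.1 hi).2 hi₀
    have hupd : ∀ i ∈ s \ T, Function.update g i₀ (∑ i ∈ T, g i) i = g i := fun i hi =>
      Function.update_of_ne (fun h : i = i₀ => hni (h ▸ hi)) _ _
    have hcard : (insert i₀ (s \ T)).card < n := by
      rw [Finset.card_insert_of_notMem hni]
      have := Finset.card_sdiff_add_card_eq_card hT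
      omega
    have h1 := ih _ hcard _ rfl _ (hu.merge hT hi₀) (by
      intro i hi
      rcases Finset.mem_insert.1 hi with rfl | hi
      · rw [Function.update_self]
        refine ⟨AddSubgroup.sum_mem _ fun i hi => (hs i (hT hi)).1, ?_⟩
        rw [Finset.smul_sum]
        exact Finset.sum_eq_zero fun i hi => (hs i (hT hi)).2
      · rw [hupd i hi]
        exact hs i (Finset.mem_sdiff.1 hi).1) (by
      intro i hi
      rcases Finset.mem_insert.1 hi with rfl | hi
      · rwa [Function.update_self]
      · rw [hupd i hi]
        exact hne i (Finset.mem_sdiff.1 hi).1)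
    refine le_trans ?_ h1
    have h2 : cross (insert i₀ (s \ T)) (Function.update g i₀ (∑ i ∈ T, g i))
        = 1 / (addOrderOf (∑ i ∈ T, g i) : ℚ) + cross (s \ T) g := by
      rw [cross, Finset.sum_insert hni, Function.update_self, cross]
      congr 1
      exact Finset.sum_congr rfl fun i hi => by rw [hupd i hi]
    have h3 : cross s g = cross (s \ T) g + cross T g := (Finset.sum_sdiff hT).symm
    rw [h2, h3]
    linarith

theorem nsmul_div_ne_zero [Finite G] {p e : ℕ} (hp : p.Prime) (hpe : p ∣ e) {x : G}
    (hx : addOrderOf x = e) : (e / p) • x ≠ 0 := by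
  intro h
  have h1 := addOrderOf_dvd_of_nsmul_eq_zero h
  have he : 0 < e := hx ▸ addOrderOf_pos x
  rw [hx] at h1
  exact absurd (Nat.le_of_dvd (Nat.div_pos (Nat.le_of_dvd he hpe) hp.pos) h1)
    (not_le.2 (Nat.div_lt_self he hp.one_lt))

/-- In a reduced family, sums of terms of order `e` vanish as soon as their `e / p`-th multiples
do. So the number of these terms is bounded by the bound for the cyclic group of order `p`. -/
theorem UniqueZeroSums.card_filter_order_le [Finite G] (hu : UniqueZeroSums s g)
    (hr : Reduced s g) {p e : ℕ} [Fact p.Prime] (hpe : p ∣ e) (ψ : ZMod p →+ G)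
    (hψ : Function.Injective ψ)
    (hrange : ∀ i ∈ s, addOrderOf (g i) = e → (e / p) • g i ∈ Set.range ψ) :
    (s.filter fun i => addOrderOf (g i) = e).card ≤ p := by
  have hp : p.Prime := Fact.out
  rcases (s.filter fun i => addOrderOf (g i) = e).eq_empty_or_nonempty with h0 | ⟨x₀, hx₀⟩
  · rw [h0]; simp
  have he : 0 < e := (Finset.mem_filter.1 hx₀).2 ▸ addOrderOf_pos _
  set A := s.filter fun i => addOrderOf (g i) = e with hA
  have hmem : ∀ i ∈ A, ∃ v, ψ v = (e / p) • g i := fun i hi =>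
    hrange i (Finset.mem_filter.1 hi).1 (Finset.mem_filter.1 hi).2
  have hex : ∀ i, ∃ v, i ∈ A → ψ v = (e / p) • g i := fun i => by
    by_cases hi : i ∈ A
    · exact (hmem i hi).imp fun v hv _ => hv
    · exact ⟨0, fun h => absurd h hi⟩
  choose f hf using hex
  have hsum : ∀ T ⊆ A, ψ (∑ i ∈ T, f i) = (e / p) • ∑ i ∈ T, g i := fun T hT => by
    rw [map_sum, Finset.smul_sum]
    exact Finset.sum_congr rfl fun i hi => hf i (hT hi)
  have hf0 : ∀ i ∈ A, f i ≠ 0 := fun i hi h => by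
    have h1 := hf i hi
    rw [h, map_zero] at h1
    exact nsmul_div_ne_zero hp hpe (Finset.mem_filter.1 hi).2 h1.symm
  have key : ∀ T ⊆ A, ∑ i ∈ T, f i = 0 → ∑ i ∈ T, g i = 0 := by
    intro T
    induction T using Finset.strongInduction with
    | H T ih =>
      intro hT hT0
      rcases le_or_gt T.card p with hcard | hcard
      · -- the sum has order dividing `e / p`, so merging at most `p` terms of order `e` would not
        -- lower the cross number
        by_contra hne
        have h2 : 2 ≤ T.card := by
          by_contra! hlt
          interval_cases h : T.card
          · rw [Finset.card_eq_zero] at h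
            exact hne (by simp [h])
          · obtain ⟨i, rfl⟩ := Finset.card_eq_one.1 h
            rw [Finset.sum_singleton] at hT0
            exact hf0 i (hT (Finset.mem_singleton_self i)) hT0
        have h3 := hr T (hT.trans (Finset.filter_subset _ _)) h2 hne
        have h4 : cross T g = T.card / e := by
          rw [cross, Finset.sum_congr rfl fun i hi => by
            rw [(Finset.mem_filter.1 (hT hi)).2], Finset.sum_const, nsmul_eq_mul]
          ring
        have h5 : addOrderOf (∑ i ∈ T, g i) ∣ e / p := addOrderOf_dvd_of_nsmul_eq_zero (by
          rw [← hsum T hT, hT0, map_zero])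
        have hpos := addOrderOf_pos (∑ i ∈ T, g i)
        obtain ⟨k, rfl⟩ := hpe
        have hk : 0 < k := Nat.pos_of_ne_zero (by rintro rfl; simp at he)
        rw [Nat.mul_div_cancel_left _ hp.pos] at h5
        have h6 := Nat.le_of_dvd hk h5
        rw [h4, div_lt_div_iff₀ (by exact_mod_cast hpos) (by exact_mod_cast he)] at h3
        have h7 : p * k < T.card * addOrderOf (∑ i ∈ T, g i) := by
          have : ((p * k : ℕ) : ℚ) < ((T.card * addOrderOf (∑ i ∈ T, g i) : ℕ) : ℚ) := by
            push_cast at h3 ⊢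
            linarith
          exact_mod_cast this
        exact absurd h7 (not_lt.2 (Nat.mul_le_mul hcard h6))
      · -- some nonempty subfamily of at most `p` terms has `f`-sum zero and can be split off
        obtain ⟨x, hx⟩ : T.Nonempty := Finset.card_pos.1 (by omega)
        obtain ⟨W, hW, hWc⟩ := Finset.exists_subset_card_eq (s := T.erase x) (n := p - 1) (by
          rw [Finset.card_erase_of_mem hx]
          omega)
        have hWT := hW.trans (Finset.erase_subset _ _)
        obtain ⟨B, hB, hB0⟩ := exists_subset_sum_eq_of_prime (s := W)
          (fun i hi => hf0 i (hT (hWT hi))) hWc.ge (-f x)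
        have hxB : x ∉ B := fun h => Finset.notMem_erase x T (hW (hB h))
        have hsub : insert x B ⊆ T := Finset.insert_subset hx (hB.trans hWT)
        have hlt : insert x B ⊂ T := by
          refine Finset.ssubset_iff_subset_ne.2 ⟨hsub, fun h => ?_⟩
          rw [← h] at hcard
          revert hcard
          rw [Finset.card_insert_of_notMem hxB]
          have := Finset.card_le_card hB
          have := hp.pos
          omega
        have h1 : ∑ i ∈ insert x B, f i = 0 := by
          rw [Finset.sum_insert hxB, hB0, add_neg_cancel]
        have h2 : ∑ i ∈ T \ insert x B, f i = 0 := by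
          rw [← Finset.sum_sdiff hsub, h1, add_zero] at hT0
          exact hT0
        rw [← Finset.sum_sdiff hsub, ih _ hlt (hsub.trans hT) h1,
          ih _ (Finset.sdiff_ssubset hsub (Finset.insert_nonempty _ _))
            (Finset.sdiff_subset.trans hT) h2, add_zero]
  have h1 : UniqueZeroSums A f := by
    refine (hu.mono (Finset.filter_subset _ _)).congr fun T hT => ⟨key T hT, fun h => ?_⟩
    apply hψ
    rw [hsum T hT, h, smul_zero, map_zero]
  exact h1.card_le_of_prime hf0

/-- Multiplication by `p` scales by `p` the inverse orders divisible by `p`, and fixes the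
others. -/
theorem cross_eq_of_prime [Finite G] {p : ℕ} [Fact p.Prime] :
    cross s g = (s.filter fun i => addOrderOf (g i) = p).card / p
      + 1 / p * cross (s \ s.filter fun i => addOrderOf (g i) = p) (fun i => p • g i)
      + (1 - 1 / p) * cross (s.filter fun i => ¬ p ∣ addOrderOf (g i)) g := by
  have hp : p.Prime := Fact.out
  have hp0 : (p : ℚ) ≠ 0 := by exact_mod_cast hp.ne_zero
  have h1 : s \ (s.filter fun i => addOrderOf (g i) = p)
      = s.filter fun i => ¬ addOrderOf (g i) = p := by
    rw [Finset.filter_not]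
  rw [h1]
  simp only [cross, Finset.card_filter, Finset.sum_filter, Nat.cast_sum, Finset.sum_div,
    Finset.mul_sum, ← Finset.sum_add_distrib]
  refine Finset.sum_congr rfl fun i hi => ?_
  have hpos := addOrderOf_pos (g i)
  by_cases h0 : addOrderOf (g i) = p
  · simp [h0]
  · by_cases hd : p ∣ addOrderOf (g i)
    · have h2 : addOrderOf (p • g i) = addOrderOf (g i) / p := by
        rw [addOrderOf_nsmul, Nat.gcd_eq_right hd]
      obtain ⟨k, hk⟩ := hd
      rw [hk, Nat.mul_div_cancel_left _ hp.pos] at h2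
      have h0' : p * k ≠ p := hk ▸ h0
      simp only [h0', h2, hk, dvd_mul_right, not_true_eq_false, if_false, if_true,
        not_false_eq_true]
      have hk0 : (k : ℚ) ≠ 0 := by
        rintro h
        have : k = 0 := by exact_mod_cast h
        rw [hk, this] at hpos
        simp at hpos
      push_cast
      field_simp
      ring
    · have h2 : addOrderOf (p • g i) = addOrderOf (g i) := by
        rw [addOrderOf_nsmul, Nat.Coprime.gcd_eq_one, Nat.div_one]
        exact ((Nat.Prime.coprime_iff_not_dvd hp).2 hd).symm
      simp only [h0, h2, hd, if_false, if_true, not_false_eq_true]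
      push_cast
      ring

/-- If the terms of order `p` have all the required elements of order `p` as subset sums, one can
pass to the family of `p`-multiples. -/
theorem UniqueZeroSums.cross_le_of_cover {ι G : Type} [DecidableEq ι] [AddCommGroup G] [Finite G]
    {s : Finset ι} {g : ι → G} (hu : UniqueZeroSums s g) {p e e₀ : ℕ}
    [Fact p.Prime] {H H' : AddSubgroup G} (hs : ∀ i ∈ s, g i ∈ H ∧ (p * e) • g i = 0)
    (hne : ∀ i ∈ s, g i ≠ 0) (hH : ∀ x ∈ H, p • x ∈ H')
    (he₀ : ∀ x : G, (p * e) • x = 0 → ¬ p ∣ addOrderOf x → e₀ • x = 0)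
    (hcov : ∀ v ∈ H, p • v = 0 → ∃ Y ⊆ s.filter fun i => addOrderOf (g i) = p, ∑ i ∈ Y, g i = v)
    {x₁ x₀ : ℚ} (h₁ : CrossBound H' e x₁) (h₀ : CrossBound H e₀ x₀) :
    cross s g ≤ (s.filter fun i => addOrderOf (g i) = p).card / p + 1 / p * x₁
      + (1 - 1 / p) * x₀ := by
  have hp : p.Prime := Fact.out
  rw [cross_eq_of_prime (p := p)]
  have hp1 : (1 : ℚ) / p ≤ 1 := by
    rw [div_le_one (by exact_mod_cast hp.pos)]
    exact_mod_cast hp.one_le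
  gcongr
  · refine h₁ ι _ _ ?_ ?_ ?_
    · refine hu.map_sdiff (Finset.filter_subset _ _) (nsmulAddMonoidHom p)
        (fun i hi => (addOrderOf_eq_prime_iff.1 (Finset.mem_filter.1 hi).2).1) fun T hT hT0 => ?_
      refine hcov _ (neg_mem (AddSubgroup.sum_mem _ fun i hi =>
        (hs i (Finset.mem_sdiff.1 (hT hi)).1).1)) ?_
      rw [smul_neg, neg_eq_zero]
      exact hT0
    · intro i hi
      have hi := hs i (Finset.mem_sdiff.1 hi).1
      refine ⟨hH _ hi.1, ?_⟩
      rw [← mul_nsmul, hi.2]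
    · intro i hi
      rw [Finset.mem_sdiff, Finset.mem_filter] at hi
      exact fun h => hi.2 ⟨hi.1, addOrderOf_eq_prime h (hne i hi.1)⟩
  · refine h₀ ι _ _ (hu.mono (Finset.filter_subset _ _)) (fun i hi => ?_)
      fun i hi => hne i (Finset.mem_filter.1 hi).1
    rw [Finset.mem_filter] at hi
    exact ⟨(hs i hi.1).1, he₀ _ (hs i hi.1).2 hi.2⟩

omit [DecidableEq ι] in
/-- Counting the terms by their order. -/
theorem cross_le_sum {κ : Type*} (I : Finset κ) (o : κ → ℕ) (N : κ → ℚ)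
    (hcov : ∀ i ∈ s, ∃ k ∈ I, addOrderOf (g i) = o k)
    (hN : ∀ k ∈ I, ((s.filter fun i => addOrderOf (g i) = o k).card : ℚ) ≤ N k) :
    cross s g ≤ ∑ k ∈ I, N k / o k := by
  calc cross s g ≤ ∑ i ∈ s, ∑ k ∈ I, if addOrderOf (g i) = o k then 1 / (o k : ℚ) else 0 := by
        refine Finset.sum_le_sum fun i hi => ?_
        obtain ⟨k, hk, hik⟩ := hcov i hi
        refine le_trans ?_ (Finset.single_le_sum (fun k _ => ?_) hk)
        · rw [if_pos hik, hik]
        · split_ifs <;> positivity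
    _ = ∑ k ∈ I, ∑ i ∈ s, if addOrderOf (g i) = o k then 1 / (o k : ℚ) else 0 :=
        Finset.sum_comm
    _ ≤ ∑ k ∈ I, N k / o k := by
        refine Finset.sum_le_sum fun k hk => ?_
        rw [← Finset.sum_filter, Finset.sum_const, nsmul_eq_mul, mul_one_div]
        gcongr
        exact hN k hk

/-- The terms of order `p`, when all of them lie in one cyclic group of order `p`: there are at most
`p` of them, and `p - 1` suffice to have all elements of the group as subset sums. -/
theorem UniqueZeroSums.card_torsion_le (hu : UniqueZeroSums s g) {p : ℕ}
    [Fact p.Prime] {H : AddSubgroup G} (hs : ∀ i ∈ s, g i ∈ H) (ψ : ZMod p →+ G)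
    (hψ : Function.Injective ψ) (hrange : ∀ x ∈ H, p • x = 0 → x ∈ Set.range ψ) :
    (s.filter fun i => addOrderOf (g i) = p).card ≤ p ∧
      (p - 1 ≤ (s.filter fun i => addOrderOf (g i) = p).card →
        ∀ v ∈ H, p • v = 0 → ∃ Y ⊆ s.filter fun i => addOrderOf (g i) = p, ∑ i ∈ Y, g i = v) := by
  set X := s.filter fun i => addOrderOf (g i) = p
  have hex : ∀ i, ∃ v, i ∈ X → ψ v = g i := fun i => by
    by_cases hi : i ∈ X
    · obtain ⟨v, hv⟩ := hrange _ (hs i (Finset.mem_filter.1 hi).1)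
        (addOrderOf_eq_prime_iff.1 (Finset.mem_filter.1 hi).2).1
      exact ⟨v, fun _ => hv⟩
    · exact ⟨0, fun h => absurd h hi⟩
  choose f hf using hex
  have hsum : ∀ T ⊆ X, ψ (∑ i ∈ T, f i) = ∑ i ∈ T, g i := fun T hT => by
    rw [map_sum]
    exact Finset.sum_congr rfl fun i hi => hf i (hT hi)
  have hf0 : ∀ i ∈ X, f i ≠ 0 := fun i hi h =>
    (addOrderOf_eq_prime_iff.1 (Finset.mem_filter.1 hi).2).2 (by rw [← hf i hi, h, map_zero])
  refine ⟨?_, fun hX v hv hpv => ?_⟩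
  · refine UniqueZeroSums.card_le_of_prime (f := f) ?_ hf0
    exact (hu.mono (Finset.filter_subset _ _)).congr fun T hT => by
      rw [← hsum T hT, map_eq_zero_iff ψ hψ]
  · obtain ⟨w, rfl⟩ := hrange v hv hpv
    obtain ⟨Y, hY, rfl⟩ := exists_subset_sum_eq_of_prime hf0 hX w
    exact ⟨Y, hY, (hsum Y hY).symm⟩

end

/-! ### Adding a prime to the exponent -/

section

variable {ι G : Type*} [DecidableEq ι] [AddCommGroup G] {s : Finset ι} {g : ι → G}

theorem nsmul_div_mem_range {p e : ℕ} (hpe : p ∣ e) {H : AddSubgroup G} {R : Set G}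
    (hR : ∀ x ∈ H, p • x = 0 → x ∈ R) {x : G} (hx : (e / p) • x ∈ H) (he : addOrderOf x = e) :
    (e / p) • x ∈ R := by
  refine hR _ hx ?_
  rw [← mul_nsmul', Nat.mul_div_cancel' hpe, ← he, addOrderOf_nsmul_eq_zero]

omit [DecidableEq ι] in
theorem cross_filter_add_cross_filter_not (P : ι → Prop) [DecidablePred P] :
    cross (s.filter P) g + cross (s.filter fun i => ¬ P i) g = cross s g :=
  Finset.sum_filter_add_sum_filter_not _ _ _

omit [DecidableEq ι] in
theorem card_filter_filter_le (P : ι → Prop) [DecidablePred P] (e : ℕ) :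
    ((s.filter P).filter fun i => addOrderOf (g i) = e).card
      ≤ (s.filter fun i => addOrderOf (g i) = e).card :=
  Finset.card_le_card (Finset.filter_subset_filter _ (Finset.filter_subset _ _))

theorem exists_eq_pow_mul_of_dvd {p a m o : ℕ} (hp : p.Prime) (hpm : ¬ p ∣ m) (hpo : p ∣ o)
    (ho : o ∣ p ^ a * m) : ∃ j < a, ∃ d, d ∣ m ∧ o = p ^ (j + 1) * d := by
  obtain ⟨y, z, hy, hz, rfl⟩ := (Nat.dvd_mul).1 ho
  obtain ⟨k, hk, rfl⟩ := (Nat.dvd_prime_pow hp).1 hy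
  rcases k with _ | k
  · exact absurd ((by simpa using hpo : p ∣ z).trans hz) hpm
  · exact ⟨k, by omega, z, hz, rfl⟩

omit [DecidableEq ι] in
/-- The count by orders for a `p`-group, when at most `c` terms have order `p` and at most `p` terms
have any other given order. -/
theorem cross_le_of_prime_pow {p a : ℕ} (hp : p.Prime) (ha : 0 < a)
    (hs : ∀ i ∈ s, p ^ a • g i = 0) (hne : ∀ i ∈ s, g i ≠ 0) {c : ℚ}
    (h₁ : ((s.filter fun i => addOrderOf (g i) = p).card : ℚ) ≤ c)
    (h₂ : ∀ j, ((s.filter fun i => addOrderOf (g i) = p ^ (j + 2)).card) ≤ p) :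
    cross s g ≤ geomSum p a + (c - p) / p := by
  have hp0 : (p : ℚ) ≠ 0 := by exact_mod_cast hp.ne_zero
  refine (cross_le_sum (Finset.range a) (fun j => p ^ (j + 1))
    (fun j => p + if j = 0 then c - p else 0) ?_ ?_).trans (le_of_eq ?_)
  · intro i hi
    obtain ⟨k, hk, hik⟩ := (Nat.dvd_prime_pow hp).1 (addOrderOf_dvd_of_nsmul_eq_zero (hs i hi))
    rcases k with _ | k
    · exact absurd (AddMonoid.addOrderOf_eq_one_iff.1 (by simpa using hik)) (hne i hi)
    · exact ⟨k, Finset.mem_range.2 (by omega), hik⟩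
  · intro j _
    rcases j with _ | j
    · simpa using h₁
    · simpa using h₂ j
  · simp only [add_div, Finset.sum_add_distrib]
    congr 1
    · refine Finset.sum_congr rfl fun j _ => ?_
      push_cast
      field_simp
      ring
    · rw [Finset.sum_eq_single_of_mem 0 (Finset.mem_range.2 ha)]
      · simp
      · intro j _ hj
        simp [hj]

end

section

variable {G : Type} [AddCommGroup G] [Finite G] {H H' : AddSubgroup G} {p P m : ℕ}
  [Fact p.Prime] [Fact P.Prime]

omit [Finite G] in
theorem nsmul_eq_zero_of_not_dvd {a : ℕ} (x : G) (hx : (p ^ a * m) • x = 0)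
    (hp : ¬ p ∣ addOrderOf x) : m • x = 0 := by
  have h1 := addOrderOf_dvd_of_nsmul_eq_zero hx
  have hpp : p.Prime := Fact.out
  have h2 : Nat.Coprime (addOrderOf x) (p ^ a) :=
    Nat.Coprime.pow_right _ ((Nat.Prime.coprime_iff_not_dvd hpp).2 hp).symm
  exact addOrderOf_dvd_iff_nsmul_eq_zero.1 (h2.dvd_of_dvd_mul_left h1)

/-- The bound for a prime `p` with cyclic `p`-torsion is added to the bound for a coprime part `m`
of the exponent, provided that `p` is wide with respect to `m`. If there are enough terms of order
`p`, one passes to the family of `p`-multiples; otherwise the terms are counted by their orders,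
and the inequality of `2`-wideness makes up for the orders other than powers of `p`. -/
theorem CrossBound.prime_pow_mul (hm : 0 < m) (hpm : ¬ p ∣ m) (ψ : ZMod p →+ G)
    (hψ : Function.Injective ψ) (hrange : ∀ x ∈ H, p • x = 0 → x ∈ Set.range ψ) {K : ℚ}
    (hK : CrossBound H m K)
    (hw : ∀ a, geomSum p a * ∑ d ∈ m.divisors, 1 / (d : ℚ) ≤ geomSum p a + 2 / p) (a : ℕ) :
    CrossBound H (p ^ a * m) (geomSum p a + K) := by
  have hp : p.Prime := Fact.out
  have hp0 : (p : ℚ) ≠ 0 := by exact_mod_cast hp.ne_zero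
  induction a with
  | zero => simpa [geomSum_zero] using hK
  | succ a ih =>
    refine crossBound_of_reduced fun ι _ s g hu hs hne hr => ?_
    obtain ⟨hX, hcov⟩ := hu.card_torsion_le (fun i hi => (hs i hi).1) ψ hψ hrange
    rcases le_or_gt (p - 1) (s.filter fun i => addOrderOf (g i) = p).card with hc | hc
    · have h1 := hu.cross_le_of_cover (p := p) (e := p ^ a * m) (e₀ := m) (H := H) (H' := H)
        (fun i hi => by rw [← mul_assoc, ← pow_succ']; exact hs i hi) hne
        (fun x hx => H.nsmul_mem hx p)
        (fun x hx hpx => nsmul_eq_zero_of_not_dvd (a := a + 1) x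
          (by rw [pow_succ', mul_assoc]; exact hx) hpx)
        (hcov hc) ih hK
      refine h1.trans ?_
      rw [geomSum_succ]
      have h2 : ((s.filter fun i => addOrderOf (g i) = p).card : ℚ) / p ≤ 1 := by
        rw [div_le_one (by exact_mod_cast hp.pos)]
        exact_mod_cast hX
      have h3 : 1 / (p : ℚ) * (geomSum p a + K) + (1 - 1 / p) * K = geomSum p a / p + K := by ring
      linarith
    · rw [← cross_filter_add_cross_filter_not (fun i => p ∣ addOrderOf (g i))]
      have hle : ∀ e, p ∣ e → (s.filter fun i => addOrderOf (g i) = e).card ≤ p := fun e he =>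
        hu.card_filter_order_le hr he ψ hψ fun i hi hie =>
          nsmul_div_mem_range he hrange (H.nsmul_mem (hs i hi).1 _) hie
      refine add_le_add ?_ (hK ι _ _ (hu.mono (Finset.filter_subset _ _)) (fun i hi => ?_)
        fun i hi => hne i (Finset.mem_filter.1 hi).1)
      · refine (cross_le_sum (Finset.range (a + 1) ×ˢ m.divisors) (fun k => p ^ (k.1 + 1) * k.2)
          (fun k => p - if k = (0, 1) then 2 else 0) ?_ ?_).trans ?_
        · intro i hi
          rw [Finset.mem_filter] at hi
          obtain ⟨j, hj, d, hd, hjd⟩ := exists_eq_pow_mul_of_dvd hp hpm hi.2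
            (addOrderOf_dvd_of_nsmul_eq_zero (hs i hi.1).2)
          exact ⟨(j, d), Finset.mem_product.2 ⟨Finset.mem_range.2 hj,
            Nat.mem_divisors.2 ⟨hd, hm.ne'⟩⟩, hjd⟩
        · rintro ⟨j, d⟩ _
          have h1 := card_filter_filter_le (s := s) (g := g) (fun i => p ∣ addOrderOf (g i))
            (p ^ (j + 1) * d)
          by_cases hjd : (j, d) = (0, 1)
          · simp only [Prod.mk.injEq] at hjd
            obtain ⟨rfl, rfl⟩ := hjd
            simp only [zero_add, pow_one, mul_one, if_true] at h1 ⊢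
            have := hp.two_le
            have h2 : ((s.filter fun i => p ∣ addOrderOf (g i)).filter
              fun i => addOrderOf (g i) = p).card + 2 ≤ p := by omega
            have h3 : ((((s.filter fun i => p ∣ addOrderOf (g i)).filter
              fun i => addOrderOf (g i) = p).card + 2 : ℕ) : ℚ) ≤ p := by exact_mod_cast h2
            push_cast at h3
            linarith
          · simp only [if_neg hjd, sub_zero]
            exact_mod_cast h1.trans (hle _ ((dvd_pow_self p (Nat.succ_ne_zero j)).mul_right d))
        · have h1 : ∑ k ∈ Finset.range (a + 1) ×ˢ m.divisors,
              ((p : ℚ) - if k = (0, 1) then 2 else 0) / ((p ^ (k.1 + 1) * k.2 : ℕ) : ℚ)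
              = geomSum p (a + 1) * ∑ d ∈ m.divisors, 1 / (d : ℚ) - 2 / p := by
            simp only [sub_div, Finset.sum_sub_distrib]
            congr 1
            · rw [Finset.sum_product, geomSum, Finset.sum_mul_sum]
              refine Finset.sum_congr rfl fun j _ => Finset.sum_congr rfl fun d hd => ?_
              have hd0 : (d : ℚ) ≠ 0 := by
                exact_mod_cast (Nat.pos_of_mem_divisors hd).ne'
              push_cast
              field_simp
              ring
            · rw [Finset.sum_eq_single_of_mem (0, 1) (Finset.mem_product.2
                ⟨Finset.mem_range.2 (Nat.succ_pos a), Nat.mem_divisors.2 ⟨one_dvd m, hm.ne'⟩⟩)]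
              · simp
              · intro k _ hk
                simp [hk]
          rw [h1]
          linarith [hw (a + 1)]
      · rw [Finset.mem_filter] at hi
        exact ⟨(hs i hi.1).1, nsmul_eq_zero_of_not_dvd (a := a + 1) _ (hs i hi.1).2 hi.2⟩

theorem add_self_plane_two : ∀ x : ZMod 2 × ZMod 2, x + x = 0 := by decide

set_option synthInstance.maxHeartbeats 400000 in
set_option synthInstance.maxSize 1000 in
theorem eq_sum_plane_two : ∀ u v w : ZMod 2 × ZMod 2, u ≠ 0 → v ≠ 0 → u ≠ v →
    w = 0 ∨ w = u ∨ w = v ∨ w = u + v := by decide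

omit [Finite G] in
/-- The terms of order `p`, when all of them lie in one elementary abelian group of rank two: there
are at most `2 * p` of them, and in case of equality (or, for `p = 2`, already from three terms on)
their subset sums are all elements of the group. -/
theorem UniqueZeroSums.card_torsion_le_of_plane {ι : Type} [DecidableEq ι] {s : Finset ι}
    {g : ι → G} (hu : UniqueZeroSums s g)
    (hs : ∀ i ∈ s, g i ∈ H) (ψ : ZMod p × ZMod p →+ G)
    (hψ : Function.Injective ψ) (hrange : ∀ x ∈ H, p • x = 0 → x ∈ Set.range ψ) :
    (s.filter fun i => addOrderOf (g i) = p).card ≤ 2 * p ∧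
      (2 * p ≤ (s.filter fun i => addOrderOf (g i) = p).card ∨
        p = 2 ∧ 3 ≤ (s.filter fun i => addOrderOf (g i) = p).card →
        ∀ v ∈ H, p • v = 0 → ∃ Y ⊆ s.filter fun i => addOrderOf (g i) = p, ∑ i ∈ Y, g i = v) := by
  set X := s.filter fun i => addOrderOf (g i) = p
  have hex : ∀ i, ∃ v, i ∈ X → ψ v = g i := fun i => by
    by_cases hi : i ∈ X
    · obtain ⟨v, hv⟩ := hrange _ (hs i (Finset.mem_filter.1 hi).1)
        (addOrderOf_eq_prime_iff.1 (Finset.mem_filter.1 hi).2).1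
      exact ⟨v, fun _ => hv⟩
    · exact ⟨0, fun h => absurd h hi⟩
  choose f hf using hex
  have hsum : ∀ T ⊆ X, ψ (∑ i ∈ T, f i) = ∑ i ∈ T, g i := fun T hT => by
    rw [map_sum]
    exact Finset.sum_congr rfl fun i hi => hf i (hT hi)
  have hf0 : ∀ i ∈ X, f i ≠ 0 := fun i hi h =>
    (addOrderOf_eq_prime_iff.1 (Finset.mem_filter.1 hi).2).2 (by rw [← hf i hi, h, map_zero])
  have huf : UniqueZeroSums X f :=
    (hu.mono (Finset.filter_subset _ _)).congr fun T hT => by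
      rw [← hsum T hT, map_eq_zero_iff ψ hψ]
  refine ⟨huf.card_le_of_plane hf0, fun hX v hv hpv => ?_⟩
  obtain ⟨w, rfl⟩ := hrange v hv hpv
  suffices h : ∃ Y ⊆ X, ∑ i ∈ Y, f i = w by
    obtain ⟨Y, hY, rfl⟩ := h
    exact ⟨Y, hY, (hsum Y hY).symm⟩
  rcases hX with hX | ⟨rfl, hX⟩
  · -- otherwise `-w` could be added as a further term
    by_contra! h
    have hw : w ≠ 0 := fun hw => h ∅ (Finset.empty_subset _) (by simp [hw])
    have h1 := (huf.insertNone (u := -w) (by simpa using h)).card_le_of_plane (by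
      intro o ho
      cases o with
      | none => simpa using hw
      | some i => exact hf0 i (by simpa using ho))
    rw [Finset.card_insertNone] at h1
    omega
  · -- two distinct nonzero vectors of the plane over the field with two elements generate it
    obtain ⟨i, hi, j, hj, hij⟩ : ∃ i ∈ X, ∃ j ∈ X, f i ≠ f j := by
      by_contra! h
      obtain ⟨i, hi, j, hj, k, hk, hij, hik, hjk⟩ := Finset.two_lt_card.1 hX
      have h1 := huf {i, j} (by grind) {j, k} (by grind)
        (by rw [Finset.sum_pair hij, h i hi j hj, add_self_plane_two])
        (by rw [Finset.sum_pair hjk, h j hj k hk, add_self_plane_two])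
      have h2 : ({i, j} ∩ {j, k} : Finset ι) = {j} := by grind
      rw [h2, Finset.sum_singleton] at h1
      exact hf0 j hj h1
    have hne : i ≠ j := fun h => hij (h ▸ rfl)
    rcases eq_sum_plane_two _ _ w (hf0 i hi) (hf0 j hj) hij with rfl | rfl | rfl | rfl
    · exact ⟨∅, Finset.empty_subset _, rfl⟩
    · exact ⟨{i}, by simpa using hi, by simp⟩
    · exact ⟨{j}, by simpa using hj, by simp⟩
    · exact ⟨{i, j}, by grind, Finset.sum_pair hne⟩

omit [Finite G] in
theorem nsmul_pow_div_mem (hH : ∀ x ∈ H, p • x ∈ H') {x : G} (hx : x ∈ H) (j d : ℕ) :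
    (p ^ (j + 2) * d / p) • x ∈ H' := by
  have hp : p.Prime := Fact.out
  rw [show p ^ (j + 2) * d = p * (p * (p ^ j * d)) by ring, Nat.mul_div_cancel_left _ hp.pos,
    mul_nsmul']
  exact hH _ (H.nsmul_mem hx _)

/-- The bound for `p`-groups of rank two whose `p`-multiples form a cyclic group. -/
theorem crossBound_prime_pow_of_plane (ψ₂ : ZMod p × ZMod p →+ G)
    (hψ₂ : Function.Injective ψ₂) (hrange₂ : ∀ x ∈ H, p • x = 0 → x ∈ Set.range ψ₂)
    (hH : ∀ x ∈ H, p • x ∈ H') (ψ₁ : ZMod p →+ G) (hψ₁ : Function.Injective ψ₁)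
    (hrange₁ : ∀ x ∈ H', p • x = 0 → x ∈ Set.range ψ₁) {a : ℕ} (ha : 0 < a) :
    CrossBound H (p ^ a) (1 + geomSum p a) := by
  have hp : p.Prime := Fact.out
  refine crossBound_of_reduced fun ι _ s g hu hs hne hr => ?_
  have h1 := (hu.card_torsion_le_of_plane (fun i hi => (hs i hi).1) ψ₂ hψ₂ hrange₂).1
  refine (cross_le_of_prime_pow hp ha (fun i hi => (hs i hi).2) hne (c := 2 * p)
    (by exact_mod_cast h1) fun j => ?_).trans (le_of_eq ?_)
  · have he : p ∣ p ^ (j + 2) := dvd_pow_self _ (by omega)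
    exact hu.card_filter_order_le hr he ψ₁ hψ₁ fun i hi hie => nsmul_div_mem_range he hrange₁
      (by simpa using nsmul_pow_div_mem hH (hs i hi).1 j 1) hie
  · have hp0 : (p : ℚ) ≠ 0 := by exact_mod_cast hp.ne_zero
    field_simp
    ring

/-- The numerical inequality behind the count by orders in the proof of
`crossBound_prime_pow_mul_of_plane`: for `x = geomSum p a` and `y = geomSum P b`, the left-hand side
bounds the contribution of the orders divisible by `p * P`, and the right-hand side is what remains
of the bound for the other orders. -/
theorem excess_nonpos {p P : ℚ} (hp : 2 ≤ p) (hP : 2 ≤ P) {c x y : ℚ}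
    (hc : c = 2 * p - 1 ∧ 3 ≤ p ∨ c = 2 ∧ p = 2) (hx1 : 1 ≤ x) (hx : x ≤ p / (p - 1))
    (hy : y ≤ P / (P - 1)) :
    y * (1 / p + (x - 1) / P) ≤ 1 - (c - p) / p + 2 / P := by
  have hp1 : 0 < p - 1 := by linarith
  have hP1 : 0 < P - 1 := by linarith
  have hp0 : 0 < p := by linarith
  have hP0 : 0 < P := by linarith
  have h1 : x - 1 ≤ 1 / (p - 1) := by
    have : p / (p - 1) = 1 + 1 / (p - 1) := by field_simp; ring
    linarith
  have h2 : y * (1 / p + (x - 1) / P) ≤ P / (P - 1) * (1 / p + 1 / (p - 1) / P) := by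
    gcongr
  refine h2.trans ?_
  rcases hc with ⟨rfl, h3⟩ | ⟨rfl, rfl⟩
  · have h4 : 1 - (2 * p - 1 - p) / p + 2 / P - P / (P - 1) * (1 / p + 1 / (p - 1) / P)
        = (2 * p * (p - 1) * (P - 1) - P * (2 * p - 1)) / (p * (p - 1) * P * (P - 1)) := by
      field_simp
      ring
    have h5 : 0 ≤ (2 * p * (p - 1) * (P - 1) - P * (2 * p - 1)) / (p * (p - 1) * P * (P - 1)) := by
      apply div_nonneg _ (by positivity)
      nlinarith [mul_nonneg (sub_nonneg.2 h3) (sub_nonneg.2 hP),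
        mul_nonneg (mul_nonneg (sub_nonneg.2 h3) (sub_nonneg.2 h3)) (sub_nonneg.2 hP)]
    linarith
  · have h4 : 1 - ((2 : ℚ) - 2) / 2 + 2 / P - P / (P - 1) * (1 / 2 + 1 / (2 - 1) / P)
        = (P ^ 2 - 4) / (2 * P * (P - 1)) := by
      field_simp
      ring
    have h5 : 0 ≤ (P ^ 2 - 4) / (2 * P * (P - 1)) := by
      apply div_nonneg _ (by positivity)
      nlinarith
    linarith


/-- The bound for a `p`-group of rank two as above, extended by a cyclic `P`-group. If there
are enough terms of order `p` or of order `P`, one passes to the family of `p`- or `P`-multiples;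
otherwise the terms are counted by their orders. -/
theorem crossBound_prime_pow_mul_of_plane (hpP : p ≠ P) (ψ₂ : ZMod p × ZMod p →+ G)
    (hψ₂ : Function.Injective ψ₂) (hrange₂ : ∀ x ∈ H, p • x = 0 → x ∈ Set.range ψ₂)
    (hH : ∀ x ∈ H, p • x ∈ H') (ψ₁ : ZMod p →+ G) (hψ₁ : Function.Injective ψ₁)
    (hrange₁ : ∀ x ∈ H', p • x = 0 → x ∈ Set.range ψ₁) (ψ : ZMod P →+ G)
    (hψ : Function.Injective ψ) (hrange : ∀ x ∈ H, P • x = 0 → x ∈ Set.range ψ) {a : ℕ}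
    (ha : 0 < a) (b : ℕ) (hB : ∀ b, CrossBound H (P ^ b) (geomSum P b))
    (hH' : ∀ b' ≤ b,
      CrossBound H' (p ^ (a - 1) * P ^ b') (geomSum p (a - 1) + geomSum P b')) :
    CrossBound H (p ^ a * P ^ b) (1 + geomSum p a + geomSum P b) := by
  have hp : p.Prime := Fact.out
  have hP : P.Prime := Fact.out
  have hp0 : (p : ℚ) ≠ 0 := by exact_mod_cast hp.ne_zero
  have hP0 : (P : ℚ) ≠ 0 := by exact_mod_cast hP.ne_zero
  have hbase := crossBound_prime_pow_of_plane ψ₂ hψ₂ hrange₂ hH ψ₁ hψ₁ hrange₁ ha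
  induction b with
  | zero => simpa [geomSum_zero] using hbase
  | succ b ih =>
    refine crossBound_of_reduced fun ι _ s g hu hs hne hr => ?_
    have hsH : ∀ i ∈ s, g i ∈ H := fun i hi => (hs i hi).1
    obtain ⟨hXp, hcovp⟩ := hu.card_torsion_le_of_plane hsH ψ₂ hψ₂ hrange₂
    obtain ⟨hXP, hcovP⟩ := hu.card_torsion_le hsH ψ hψ hrange
    by_cases hA : 2 * p ≤ (s.filter fun i => addOrderOf (g i) = p).card ∨
        p = 2 ∧ 3 ≤ (s.filter fun i => addOrderOf (g i) = p).card
    · have he : p * (p ^ (a - 1) * P ^ (b + 1)) = p ^ a * P ^ (b + 1) := by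
        rw [← mul_assoc, ← pow_succ', Nat.sub_add_cancel ha]
      have h1 := hu.cross_le_of_cover (p := p) (e := p ^ (a - 1) * P ^ (b + 1))
        (e₀ := P ^ (b + 1)) (fun i hi => by rw [he]; exact hs i hi) hne hH
        (fun x hx hpx => nsmul_eq_zero_of_not_dvd (a := a) x (by rw [← he]; exact hx) hpx)
        (hcovp hA) (hH' (b + 1) le_rfl) (hB (b + 1))
      refine h1.trans ?_
      have h2 : ((s.filter fun i => addOrderOf (g i) = p).card : ℚ) / p ≤ 2 := by
        rw [div_le_iff₀ (by exact_mod_cast hp.pos)]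
        exact_mod_cast hXp
      have h3 : geomSum p a = 1 + geomSum p (a - 1) / p := by
        rw [← geomSum_succ, Nat.sub_add_cancel ha]
      have h4 : 1 / (p : ℚ) * (geomSum p (a - 1) + geomSum P (b + 1))
          + (1 - 1 / p) * geomSum P (b + 1) = geomSum p (a - 1) / p + geomSum P (b + 1) := by ring
      linarith
    by_cases hB' : P - 1 ≤ (s.filter fun i => addOrderOf (g i) = P).card
    · have he : P * (p ^ a * P ^ b) = P ^ (b + 1) * p ^ a := by ring
      have h1 := hu.cross_le_of_cover (p := P) (e := p ^ a * P ^ b) (e₀ := p ^ a) (H' := H)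
        (fun i hi => by rw [he, mul_comm]; exact hs i hi) hne (fun x hx => H.nsmul_mem hx P)
        (fun x hx hpx => nsmul_eq_zero_of_not_dvd (a := b + 1) x (by rw [← he]; exact hx) hpx)
        (hcovP hB') (ih fun b' hb' => hH' b' (hb'.trans (Nat.le_succ b))) hbase
      refine h1.trans ?_
      have h2 : ((s.filter fun i => addOrderOf (g i) = P).card : ℚ) / P ≤ 1 := by
        rw [div_le_one (by exact_mod_cast hP.pos)]
        exact_mod_cast hXP
      have h3 := geomSum_succ (p := P) b
      have h4 : 1 / (P : ℚ) * (1 + geomSum p a + geomSum P b) + (1 - 1 / P) * (1 + geomSum p a)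
          = geomSum P b / P + (1 + geomSum p a) := by ring
      linarith
    have hp2 := hp.two_le
    have hP2 := hP.two_le
    push Not at hA
    -- the largest number of terms of order `p` which may fail to have all the required subset sums
    obtain ⟨c, hXc, hc⟩ : ∃ c : ℚ, ((s.filter fun i => addOrderOf (g i) = p).card : ℚ) ≤ c ∧
        (c = 2 * p - 1 ∧ (3 : ℚ) ≤ p ∨ c = 2 ∧ (p : ℚ) = 2) := by
      rcases Nat.eq_or_lt_of_le hp2 with h2 | h3
      · refine ⟨2, ?_, Or.inr ⟨rfl, by exact_mod_cast h2.symm⟩⟩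
        have := hA.2 h2.symm
        exact_mod_cast Nat.lt_succ_iff.1 this
      · refine ⟨2 * p - 1, ?_, Or.inl ⟨rfl, by exact_mod_cast h3⟩⟩
        rw [le_sub_iff_add_le]
        exact_mod_cast hA.1
    have hlep : ∀ j d, (s.filter fun i => addOrderOf (g i) = p ^ (j + 2) * d).card ≤ p :=
      fun j d => by
        have he : p ∣ p ^ (j + 2) * d := (dvd_pow_self p (by omega)).mul_right d
        exact hu.card_filter_order_le hr he ψ₁ hψ₁ fun i hi hie =>
          nsmul_div_mem_range he hrange₁ (nsmul_pow_div_mem hH (hsH i hi) j d) hie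
    have hleP : ∀ e, P ∣ e → (s.filter fun i => addOrderOf (g i) = e).card ≤ P := fun e he =>
      hu.card_filter_order_le hr he ψ hψ fun i hi hie =>
        nsmul_div_mem_range he hrange (H.nsmul_mem (hsH i hi) _) hie
    have hpP' : ¬ p ∣ P ^ (b + 1) := fun h =>
      hpP ((Nat.prime_dvd_prime_iff_eq hp hP).1 (hp.dvd_of_dvd_pow h))
    have h0 : cross (s.filter fun i => ¬ p ∣ addOrderOf (g i)) g
        ≤ geomSum P (b + 1) + ((P - 2) - P) / P := by
      refine cross_le_of_prime_pow hP (Nat.succ_pos b) (fun i hi => ?_)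
        (fun i hi => hne i (Finset.mem_filter.1 hi).1) ?_
        fun j => (card_filter_filter_le _ _).trans (hleP _ (dvd_pow_self P (by omega)))
      · rw [Finset.mem_filter] at hi
        exact nsmul_eq_zero_of_not_dvd (a := a) _ (hs i hi.1).2 hi.2
      · rw [le_sub_iff_add_le]
        have h1 : ((s.filter fun i => ¬ p ∣ addOrderOf (g i)).filter
            fun i => addOrderOf (g i) = P).card + 2 ≤ P := by
          have := card_filter_filter_le (s := s) (g := g) (fun i => ¬ p ∣ addOrderOf (g i)) P
          omega
        exact_mod_cast h1
    have h10 : cross ((s.filter fun i => p ∣ addOrderOf (g i)).filter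
        fun i => ¬ P ∣ addOrderOf (g i)) g ≤ geomSum p a + (c - p) / p := by
      refine cross_le_of_prime_pow hp ha (fun i hi => ?_)
        (fun i hi => hne i (Finset.mem_filter.1 (Finset.mem_filter.1 hi).1).1) ?_
        fun j => ((card_filter_filter_le _ _).trans (card_filter_filter_le _ _)).trans
          (by simpa using hlep j 1)
      · rw [Finset.mem_filter, Finset.mem_filter] at hi
        exact nsmul_eq_zero_of_not_dvd (p := P) (a := b + 1) _
          (by rw [mul_comm]; exact (hs i hi.1.1).2) hi.2
      · refine le_trans ?_ hXc
        exact_mod_cast (card_filter_filter_le _ _).trans (card_filter_filter_le _ _)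
    have h11 : cross ((s.filter fun i => p ∣ addOrderOf (g i)).filter
        fun i => P ∣ addOrderOf (g i)) g
        ≤ geomSum P (b + 1) * (1 / p + (geomSum p a - 1) / P) := by
      refine (cross_le_sum (Finset.range a ×ˢ Finset.range (b + 1))
        (fun k => p ^ (k.1 + 1) * P ^ (k.2 + 1)) (fun k => if k.1 = 0 then P else p) ?_ ?_).trans
        (le_of_eq ?_)
      · intro i hi
        rw [Finset.mem_filter, Finset.mem_filter] at hi
        obtain ⟨j, hj, d, hd, hjd⟩ := exists_eq_pow_mul_of_dvd hp hpP' hi.1.2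
          (addOrderOf_dvd_of_nsmul_eq_zero (hs i hi.1.1).2)
        obtain ⟨k, hk, rfl⟩ := (Nat.dvd_prime_pow hP).1 hd
        rcases k with _ | k
        · exfalso
          have h1 := hi.2
          rw [hjd, pow_zero, mul_one] at h1
          exact hpP ((Nat.prime_dvd_prime_iff_eq hP hp).1 (hP.dvd_of_dvd_pow h1)).symm
        · exact ⟨(j, k), by simp only [Finset.mem_product, Finset.mem_range]; omega, hjd⟩
      · rintro ⟨j, k⟩ _
        have h1 := (card_filter_filter_le (s := s.filter fun i => p ∣ addOrderOf (g i)) (g := g)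
          (fun i => P ∣ addOrderOf (g i)) (p ^ (j + 1) * P ^ (k + 1))).trans
          (card_filter_filter_le _ _)
        rcases j with _ | j
        · simp only [if_true]
          exact_mod_cast h1.trans (hleP _ ((dvd_pow_self P (Nat.succ_ne_zero k)).mul_left _))
        · simp only [Nat.succ_ne_zero, if_false]
          exact_mod_cast h1.trans (hlep _ _)
      · obtain ⟨a, rfl⟩ : ∃ a', a = a' + 1 := ⟨a - 1, by omega⟩
        have h1 : (geomSum p (a + 1) - 1) / P
            = ∑ j ∈ Finset.range a, 1 / ((p : ℚ) ^ (j + 1) * P) := by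
          rw [geomSum_succ, geomSum, add_sub_cancel_left, Finset.sum_div, Finset.sum_div]
          refine Finset.sum_congr rfl fun j _ => ?_
          rw [pow_succ]
          field_simp
        rw [h1, Finset.sum_product, mul_comm, add_comm (1 / (p : ℚ)), Finset.sum_range_succ',
          add_mul, Finset.sum_mul, geomSum]
        congr 1
        · refine Finset.sum_congr rfl fun j _ => ?_
          rw [Finset.mul_sum]
          refine Finset.sum_congr rfl fun k _ => ?_
          simp only [Nat.succ_ne_zero, if_false]
          push_cast
          field_simp
          ring
        · rw [Finset.mul_sum]
          refine Finset.sum_congr rfl fun k _ => ?_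
          simp only [if_true]
          push_cast
          field_simp
          ring
    rw [← cross_filter_add_cross_filter_not (fun i => p ∣ addOrderOf (g i)),
      ← cross_filter_add_cross_filter_not (s := s.filter fun i => p ∣ addOrderOf (g i))
        (fun i => P ∣ addOrderOf (g i))]
    have hx1 : 1 ≤ geomSum p a := by
      rw [show a = (a - 1) + 1 by omega, geomSum_succ]
      have := geomSum_nonneg p (a - 1)
      have : 0 ≤ geomSum p (a - 1) / p := by positivity
      linarith
    have h2 := excess_nonpos (p := p) (P := P) (by exact_mod_cast hp2) (by exact_mod_cast hP2) hc
      hx1 (geomSum_le hp2 a) (geomSum_le hP2 (b + 1))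
    have h3 : ((P : ℚ) - 2 - P) / P = - (2 / P) := by ring
    linarith

end

/-! ### Wide primes -/

theorem kOneTerm_eq_geomSum {p : ℕ} (hp : p.Prime) (e : ℕ) : kOneTerm p e = geomSum p e := by
  rw [kOneTerm_eq hp le_rfl, geomSum]
  refine Finset.sum_congr rfl fun j hj => ?_
  have hj := Finset.mem_range.1 hj
  rw [min_eq_left (by omega), min_eq_left (by omega)]
  push_cast
  ring

theorem sum_inv_divisors_eq {m : ℕ} (hm : m ≠ 0) : ∑ d ∈ m.divisors, 1 / (d : ℚ)
    = ∏ q ∈ m.primeFactors, ((q : ℚ) ^ (m.factorization q + 1) - 1) /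
        ((q : ℚ) ^ (m.factorization q + 1) - (q : ℚ) ^ m.factorization q) := by
  have h := Nat.multiplicative_factorization (fun m : ℕ => ∑ d ∈ m.divisors, 1 / (d : ℚ))
    (fun x y hxy => by
      rw [Nat.divisors_mul, Finset.mul_def, Finset.sum_image, Finset.sum_product,
        Finset.sum_mul_sum]
      · refine Finset.sum_congr rfl fun a _ => Finset.sum_congr rfl fun b _ => ?_
        push_cast
        rw [div_mul_div_comm, one_mul]
      · intro a ha b hb hab
        exact hxy.mul_injOn_divisors (by simpa using ha) (by simpa using hb) hab) (by simp) hm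
  refine h.trans (Finset.prod_congr rfl fun q hq => ?_)
  have hq := Nat.prime_of_mem_primeFactors hq
  change ∑ d ∈ (q ^ m.factorization q).divisors, 1 / (d : ℚ) = _
  rw [Nat.sum_divisors_prime_pow hq]
  have h1 := kOneTerm_eq_geomSum hq (m.factorization q + 1)
  rw [kOneTerm, Nat.add_sub_cancel] at h1
  rw [h1, geomSum]
  push_cast
  rfl

theorem geomSum_mul_le_of_sum_le {p : ℕ} (hp : p.Prime) {D : ℚ} (hD1 : 1 ≤ D)
    (hD : D ≤ ((p : ℚ) ^ 2 + 2 * p - 2) / (p : ℚ) ^ 2) (a : ℕ) :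
    geomSum p a * D ≤ geomSum p a + 2 / p := by
  have hp2 : (2 : ℚ) ≤ p := by exact_mod_cast hp.two_le
  have h1 : (0 : ℚ) < p - 1 := by linarith
  have h2 : geomSum p a * (D - 1)
      ≤ p / (p - 1) * (((p : ℚ) ^ 2 + 2 * p - 2) / (p : ℚ) ^ 2 - 1) := by
    have := geomSum_nonneg p a
    have h3 := geomSum_le hp.two_le a
    have h4 : 0 ≤ D - 1 := by linarith
    gcongr
  have h5 : (p : ℚ) / (p - 1) * (((p : ℚ) ^ 2 + 2 * p - 2) / (p : ℚ) ^ 2 - 1) = 2 / p := by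
    field_simp
    ring
  linarith

theorem one_le_sum_inv_divisors {m : ℕ} (hm : m ≠ 0) : 1 ≤ ∑ d ∈ m.divisors, 1 / (d : ℚ) := by
  have h := Finset.single_le_sum (f := fun d : ℕ => 1 / (d : ℚ)) (s := m.divisors)
    (fun d _ => by positivity) (Nat.one_mem_divisors.2 hm)
  simpa using h

/-- The largest prime factor is wide with respect to the empty product `1`, so the condition in
`TwoWide` may be used for all prime factors. It is inherited by divisors. -/
theorem TwoWide.geomSum_mul_le {n p : ℕ} (hn : TwoWide n) (hp : p ∈ n.primeFactors) {m : ℕ}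
    (hm : m ∣ ∏ q ∈ n.primeFactors with p < q, q ^ n.factorization q) (a : ℕ) :
    geomSum p a * ∑ d ∈ m.divisors, 1 / (d : ℚ) ≤ geomSum p a + 2 / p := by
  have hpp := Nat.prime_of_mem_primeFactors hp
  have hM : ∏ q ∈ n.primeFactors with p < q, q ^ n.factorization q ≠ 0 :=
    Finset.prod_ne_zero_iff.2 fun q hq =>
      pow_ne_zero _ (Nat.prime_of_mem_primeFactors (Finset.mem_filter.1 hq).1).ne_zero
  have hm0 : m ≠ 0 := ne_zero_of_dvd_ne_zero hM hm
  by_cases h : ∃ q ∈ n.primeFactors, p < q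
  · obtain ⟨-, -, -, h1⟩ := hn.2 p hp h
    rw [← sum_inv_divisors_eq hM] at h1
    refine geomSum_mul_le_of_sum_le hpp (one_le_sum_inv_divisors hm0) (le_trans ?_ h1) a
    exact Finset.sum_le_sum_of_subset_of_nonneg (Nat.divisors_subset_of_dvd hM hm)
      fun d _ _ => by positivity
  · rw [Finset.filter_false_of_mem fun q hq hpq => h ⟨q, hq, hpq⟩, Finset.prod_empty,
      Nat.dvd_one] at hm
    have : (0 : ℚ) ≤ 2 / p := by positivity
    simpa [hm] using this

/-! ### The upper bound -/

/-- The elements of `H` killed by `p` lie in a cyclic group of order `p`. -/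
def HasCyclicTorsion {G : Type*} [AddCommGroup G] (H : AddSubgroup G) (p : ℕ) : Prop :=
  ∃ ψ : ZMod p →+ G, Function.Injective ψ ∧ ∀ x ∈ H, p • x = 0 → x ∈ Set.range ψ

/-- A bound for the part of the exponent coming from the largest prime factors is extended to
smaller primes with cyclic torsion, in decreasing order. -/
theorem TwoWide.crossBound_extend {G : Type} [AddCommGroup G] [Finite G] {H : AddSubgroup G}
    {n : ℕ} (hn : TwoWide n) {S : Finset ℕ} (hS : S ⊆ n.primeFactors)
    (hup : ∀ p ∈ S, ∀ q ∈ n.primeFactors, p < q → q ∈ S) {x : ℚ}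
    (hx : CrossBound H (∏ q ∈ S, q ^ n.factorization q) x) {T : Finset ℕ}
    (hT : T ⊆ n.primeFactors) (hd : Disjoint T S)
    (hupT : ∀ p ∈ T, ∀ q ∈ n.primeFactors, p < q → q ∈ T ∪ S)
    (hcyc : ∀ p ∈ T, HasCyclicTorsion H p) :
    CrossBound H (∏ q ∈ T ∪ S, q ^ n.factorization q)
      (∑ q ∈ T, geomSum q (n.factorization q) + x) := by
  induction T using Finset.induction_on_min with
  | empty => simpa using hx
  | insert p T hlt ih =>
    rw [Finset.disjoint_insert_left] at hd
    have hpn := hT (Finset.mem_insert_self p T)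
    have hpp := Nat.prime_of_mem_primeFactors hpn
    have : Fact p.Prime := ⟨hpp⟩
    have hpT : p ∉ T := fun h => (hlt p h).false
    have hpTS : p ∉ T ∪ S := fun h => (Finset.mem_union.1 h).elim hpT hd.1
    have hltS : ∀ q ∈ T ∪ S, p < q := by
      intro q hq
      rcases Finset.mem_union.1 hq with hq | hq
      · exact hlt q hq
      · rcases lt_trichotomy p q with h | rfl | h
        · exact h
        · exact absurd hq hd.1
        · exact absurd (hup q hq p hpn h) hd.1
    have hTS : T ∪ S ⊆ n.primeFactors :=
      Finset.union_subset ((Finset.subset_insert _ _).trans hT) hS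
    have ih := ih ((Finset.subset_insert _ _).trans hT) hd.2 (fun q hq r hr hqr => by
        have := hupT q (Finset.mem_insert_of_mem hq) r hr hqr
        rw [Finset.insert_union, Finset.mem_insert] at this
        refine this.resolve_left ?_
        rintro rfl
        exact (hlt q hq).not_gt hqr) fun q hq => hcyc q (Finset.mem_insert_of_mem hq)
    have hfilter : n.primeFactors.filter (p < ·) = T ∪ S := by
      ext q
      rw [Finset.mem_filter]
      refine ⟨fun hq => ?_, fun hq => ⟨hTS hq, hltS q hq⟩⟩
      have := hupT p (Finset.mem_insert_self _ _) q hq.1 hq.2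
      rw [Finset.insert_union, Finset.mem_insert] at this
      exact this.resolve_left hq.2.ne'
    obtain ⟨ψ, hψ, hrange⟩ := hcyc p (Finset.mem_insert_self _ _)
    rw [Finset.insert_union, Finset.prod_insert hpTS, Finset.sum_insert hpT, add_assoc]
    refine CrossBound.prime_pow_mul (Finset.prod_pos fun q hq =>
      pow_pos (Nat.prime_of_mem_primeFactors (hTS hq)).pos _) ?_ ψ hψ hrange ih
      (hn.geomSum_mul_le hpn (by rw [hfilter])) _
    intro hdvd
    obtain ⟨q, hq, hpq⟩ := (Prime.dvd_finsetProd_iff hpp.prime _).1 hdvd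
    have := (Nat.prime_dvd_prime_iff_eq hpp (Nat.prime_of_mem_primeFactors (hTS hq))).1
      (hpp.dvd_of_dvd_pow hpq)
    exact hpTS (this ▸ hq)

theorem hasCyclicTorsion_zmod {n p : ℕ} [NeZero n] (hp : p.Prime) (hpn : p ∣ n) :
    HasCyclicTorsion (⊤ : AddSubgroup (ZMod n)) p := by
  obtain ⟨k, rfl⟩ := hpn
  have hk : (k : ℤ) ≠ 0 := by
    have := NeZero.ne (p * k)
    rintro h
    simp_all
  have hp0 : (p : ℤ) ≠ 0 := by exact_mod_cast hp.ne_zero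
  let f : ℤ →+ ZMod (p * k) := (Int.castAddHom (ZMod (p * k))).comp (AddMonoidHom.mulLeft (k : ℤ))
  have hf : ∀ z : ℤ, f z = ((k * z : ℤ) : ZMod (p * k)) := fun _ => rfl
  have hf0 : ∀ z : ℤ, f z = 0 ↔ (p : ℤ) ∣ z := fun z => by
    rw [hf, ZMod.intCast_zmod_eq_zero_iff_dvd]
    push_cast
    rw [mul_comm (p : ℤ), mul_dvd_mul_iff_left hk]
  refine ⟨ZMod.lift p ⟨f, (hf0 _).2 dvd_rfl⟩, ?_, fun x _ hx => ?_⟩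
  · rw [ZMod.lift_injective]
    intro z hz
    exact (ZMod.intCast_zmod_eq_zero_iff_dvd z p).2 ((hf0 z).1 hz)
  · obtain ⟨z, rfl⟩ := ZMod.intCast_surjective x
    have h1 : ((p * z : ℤ) : ZMod (p * k)) = 0 := by
      push_cast
      rw [← nsmul_eq_mul]
      exact hx
    rw [ZMod.intCast_zmod_eq_zero_iff_dvd] at h1
    push_cast at h1
    obtain ⟨w, rfl⟩ := (mul_dvd_mul_iff_left hp0).1 h1
    exact ⟨w, by rw [ZMod.lift_coe]; rfl⟩

section

variable {n q : ℕ} [NeZero n] [NeZero q]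

theorem prod_pow_factorization_eq : ∏ p ∈ n.primeFactors, p ^ n.factorization p = n :=
  Nat.prod_factorization_pow_eq_self (NeZero.ne n)

theorem TwoWide.crossBound_zmod (hn : TwoWide n) :
    CrossBound (⊤ : AddSubgroup (ZMod n)) n
      (∑ p ∈ n.primeFactors, geomSum p (n.factorization p)) := by
  have h := hn.crossBound_extend (H := (⊤ : AddSubgroup (ZMod n))) (S := ∅) (x := 0)
    (Finset.empty_subset _) (by simp) (by simpa using crossBound_one _) (T := n.primeFactors)
    subset_rfl (by simp) (fun p _ r hr _ => by simpa using hr)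
    fun p hp => hasCyclicTorsion_zmod (Nat.prime_of_mem_primeFactors hp)
      (Nat.dvd_of_mem_primeFactors hp)
  simpa [prod_pow_factorization_eq] using h

omit [NeZero q] in
theorem hasCyclicTorsion_prod {H : AddSubgroup (ZMod n × ZMod q)} {p : ℕ} (hp : p.Prime)
    (hpn : p ∣ n) (h : ∀ x ∈ H, p • x = 0 → x.2 = 0) : HasCyclicTorsion H p := by
  obtain ⟨ψ, hψ, hrange⟩ := hasCyclicTorsion_zmod hp hpn
  refine ⟨(AddMonoidHom.inl _ _).comp ψ, fun a b hab => hψ (congrArg Prod.fst hab), ?_⟩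
  intro x hx hpx
  obtain ⟨v, hv⟩ := hrange x.1 trivial (congrArg Prod.fst hpx)
  exact ⟨v, Prod.ext hv (h x hx hpx).symm⟩

omit [NeZero q] in
theorem hasCyclicTorsion_prod_of_ne {H : AddSubgroup (ZMod n × ZMod q)} {p : ℕ} (hp : p.Prime)
    (hpn : p ∣ n) (hq : q.Prime) (hpq : p ≠ q) : HasCyclicTorsion H p := by
  refine hasCyclicTorsion_prod hp hpn fun x _ hx => ?_
  obtain ⟨a, b⟩ := x
  have h1 : p • b = 0 := congrArg Prod.snd hx
  have h2 : q • b = 0 := by simp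
  have h3 := Nat.dvd_gcd (addOrderOf_dvd_of_nsmul_eq_zero h1) (addOrderOf_dvd_of_nsmul_eq_zero h2)
  rw [(Nat.coprime_primes hp hq).2 hpq, Nat.dvd_one, AddMonoid.addOrderOf_eq_one_iff] at h3
  exact h3

omit [NeZero q] in
theorem IsLargestPrimeFactor.mem (h : IsLargestPrimeFactor n q) : q ∈ n.primeFactors :=
  Nat.mem_primeFactors.2 ⟨h.1.1, h.1.2, NeZero.ne n⟩

omit [NeZero n] [NeZero q] in
theorem IsLargestPrimeFactor.le (h : IsLargestPrimeFactor n q) {p : ℕ} (hp : p ∈ n.primeFactors) :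
    p ≤ q :=
  h.2 ⟨Nat.prime_of_mem_primeFactors hp, Nat.dvd_of_mem_primeFactors hp⟩

theorem TwoWide.crossBound_prod (hn : TwoWide n)
    (hq : IsLargestPrimeFactor n q ∨ IsSecondLargestPrimeFactor n q) :
    CrossBound (⊤ : AddSubgroup (ZMod n × ZMod q)) n
      (1 + ∑ p ∈ n.primeFactors, geomSum p (n.factorization p)) := by
  have hqn : q ∈ n.primeFactors := by
    rcases hq with hq | ⟨r, hr, hq⟩
    · exact hq.mem
    · exact Nat.mem_primeFactors.2 ⟨hq.1.1, hq.1.2.1, NeZero.ne n⟩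
  have hqp := Nat.prime_of_mem_primeFactors hqn
  have : Fact q.Prime := ⟨hqp⟩
  have hv : 0 < n.factorization q :=
    hqp.factorization_pos_of_dvd (NeZero.ne n) (Nat.dvd_of_mem_primeFactors hqn)
  set H' : AddSubgroup (ZMod n × ZMod q) := AddSubgroup.prod ⊤ ⊥
  have hH : ∀ x ∈ (⊤ : AddSubgroup (ZMod n × ZMod q)), q • x ∈ H' := by
    rintro ⟨a, b⟩ _
    exact AddSubgroup.mem_prod.2 ⟨trivial, by simp⟩
  obtain ⟨ψ₁, hψ₁, hrange₁⟩ : HasCyclicTorsion H' q :=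
    hasCyclicTorsion_prod hqp (Nat.dvd_of_mem_primeFactors hqn)
      fun x hx _ => (AddSubgroup.mem_prod.1 hx).2
  obtain ⟨ψ₀, hψ₀, hrange₀⟩ := hasCyclicTorsion_zmod hqp (Nat.dvd_of_mem_primeFactors hqn)
  have hψ₂ : Function.Injective (AddMonoidHom.prodMap ψ₀ (AddMonoidHom.id (ZMod q))) :=
    Function.Injective.prodMap hψ₀ Function.injective_id
  have hrange₂ : ∀ x ∈ (⊤ : AddSubgroup (ZMod n × ZMod q)), q • x = 0 →
      x ∈ Set.range (AddMonoidHom.prodMap ψ₀ (AddMonoidHom.id (ZMod q))) := by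
    rintro ⟨a, b⟩ _ hx
    obtain ⟨v, hv⟩ := hrange₀ a trivial (congrArg Prod.fst hx)
    exact ⟨(v, b), Prod.ext hv rfl⟩
  -- it suffices to find a base set of large primes containing `q`
  suffices h : ∃ S ⊆ n.primeFactors, q ∈ S ∧ (∀ p ∈ S, ∀ r ∈ n.primeFactors, p < r → r ∈ S) ∧
      CrossBound (⊤ : AddSubgroup (ZMod n × ZMod q)) (∏ p ∈ S, p ^ n.factorization p)
        (1 + ∑ p ∈ S, geomSum p (n.factorization p)) by
    obtain ⟨S, hS, hqS, hup, hbound⟩ := h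
    have h1 := hn.crossBound_extend hS hup hbound (T := n.primeFactors \ S) Finset.sdiff_subset
      Finset.sdiff_disjoint
      (fun p _ r hr _ => by rwa [Finset.sdiff_union_of_subset hS])
      fun p hp => hasCyclicTorsion_prod_of_ne (Nat.prime_of_mem_primeFactors
        (Finset.mem_sdiff.1 hp).1) (Nat.dvd_of_mem_primeFactors (Finset.mem_sdiff.1 hp).1) hqp
        fun h => (Finset.mem_sdiff.1 hp).2 (h ▸ hqS)
    rw [Finset.sdiff_union_of_subset hS, prod_pow_factorization_eq] at h1
    refine h1.mono (le_of_eq ?_)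
    rw [← Finset.sum_sdiff hS]
    ring
  rcases hq with hq | ⟨r, hr, hq⟩
  · refine ⟨{q}, by simpa using hqn, by simp, fun p hp r hr hpr => ?_, ?_⟩
    · rw [Finset.mem_singleton] at hp ⊢
      exact absurd (hq.le hr) (not_le.2 (hp ▸ hpr))
    · simpa using crossBound_prime_pow_of_plane _ hψ₂ hrange₂ hH ψ₁ hψ₁ hrange₁ hv
  · have hrp := hr.1.1
    have : Fact r.Prime := ⟨hrp⟩
    have hrn : r ∈ n.primeFactors := Nat.mem_primeFactors.2 ⟨hrp, hr.1.2, NeZero.ne n⟩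
    have hqr : q ≠ r := hq.1.2.2
    have hlt : q < r := lt_of_le_of_ne (hr.2 ⟨hqp, hq.1.2.1⟩) hqr
    have hrle : ∀ t ∈ n.primeFactors, t ≤ r := fun t ht =>
      hr.2 ⟨Nat.prime_of_mem_primeFactors ht, Nat.dvd_of_mem_primeFactors ht⟩
    have hqle : ∀ t ∈ n.primeFactors, t ≠ r → t ≤ q := fun t ht htr =>
      hq.2 ⟨Nat.prime_of_mem_primeFactors ht, Nat.dvd_of_mem_primeFactors ht, htr⟩
    refine ⟨{q, r}, by simp [Finset.insert_subset_iff, hqn, hrn], by simp, ?_, ?_⟩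
    · intro p hp t ht hpt
      by_cases htr : t = r
      · simp [htr]
      · have h1 := hqle t ht htr
        have h2 := hrle t ht
        simp only [Finset.mem_insert, Finset.mem_singleton] at hp
        omega
    · have hcyc : HasCyclicTorsion (⊤ : AddSubgroup (ZMod n × ZMod q)) r :=
        hasCyclicTorsion_prod_of_ne hrp hr.1.2 hqp hqr.symm
      obtain ⟨ψ, hψ, hrange⟩ := hcyc
      have hB : ∀ K : AddSubgroup (ZMod n × ZMod q), ∀ b, CrossBound K (r ^ b) (geomSum r b) := by
        intro K b
        have h1 := CrossBound.prime_pow_mul (H := K) (p := r) one_pos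
          (fun h => hrp.one_lt.ne' (Nat.dvd_one.1 h)) ψ hψ (fun x _ => hrange x trivial)
          (crossBound_one K) (fun a => by
            have : (0 : ℚ) ≤ 2 / r := by positivity
            simpa using this) b
        simpa using h1
      rw [Finset.prod_pair hqr, Finset.sum_pair hqr, ← add_assoc]
      refine crossBound_prime_pow_mul_of_plane hqr _ hψ₂ hrange₂ hH ψ₁ hψ₁ hrange₁ ψ hψ hrange hv
        _ (hB ⊤) fun b hb => ?_
      have hqrb : ¬ q ∣ r ^ b := fun h =>
        hqr ((Nat.prime_dvd_prime_iff_eq hqp hrp).1 (hqp.dvd_of_dvd_pow h))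
      refine CrossBound.prime_pow_mul (pow_pos hrp.pos b) hqrb ψ₁ hψ₁ hrange₁ (hB H' b)
        (hn.geomSum_mul_le hqn ?_) _
      refine (pow_dvd_pow r hb).trans (Finset.dvd_prod_of_mem (fun t => t ^ n.factorization t) ?_)
      exact Finset.mem_filter.2 ⟨hrn, hlt⟩

end

/-! ### Unique factorization of indexed sequences -/

namespace IndexedSeq

variable {G : Type*} [AddCommGroup G]

theorem sigma_add (S T : IndexedSeq G) : (S + T).sigma = S.sigma + T.sigma := by
  simp [sigma]

theorem sigma_val (F : Finset ({g : G // g ≠ 0} × ℕ)) :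
    sigma F.val = ∑ x ∈ F, (x.1 : G) := rfl

theorem isZeroSum_sub [DecidableEq G] {S T : IndexedSeq G} (hTS : T ≤ S) (hS : S.IsZeroSum)
    (hT : T.IsZeroSum) : (S - T).IsZeroSum := by
  have h := sigma_add T (S - T)
  rw [add_tsub_cancel_of_le hTS, hS, hT, zero_add] at h
  exact h.symm

theorem exists_isIrreducible_le {S : IndexedSeq G} (hS : S.IsZeroSum) (h0 : S ≠ 0) :
    ∃ U ≤ S, U.IsIrreducible := by
  induction S using Multiset.strongInductionOn with
  | _ S ih =>
    by_cases h : ∃ T : IndexedSeq G, T < S ∧ T ≠ 0 ∧ T.IsZeroSum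
    · obtain ⟨T, hT, hT0, hTs⟩ := h
      obtain ⟨U, hU, hUi⟩ := ih T hT hTs hT0
      exact ⟨U, hU.trans hT.le, hUi⟩
    · refine ⟨S, le_rfl, h0, hS, fun T hT hT0 hTs => ?_⟩
      by_contra hne
      exact h ⟨T, lt_of_le_of_ne hT hne, hT0, hTs⟩

theorem exists_isFactorization {S : IndexedSeq G} (hS : S.IsZeroSum) :
    ∃ Z, S.IsFactorization Z := by
  classical
  induction S using Multiset.strongInductionOn with
  | _ S ih =>
    by_cases h0 : S = 0
    · exact ⟨0, by simp, by simp [h0]⟩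
    · obtain ⟨U, hU, hUi⟩ := exists_isIrreducible_le hS h0
      have hlt : S - U < S := by
        refine lt_of_le_of_ne tsub_le_self fun h => hUi.1 ?_
        have h1 := tsub_add_cancel_of_le hU
        rw [h] at h1
        simpa using h1
      obtain ⟨Z, hZ, hZS⟩ := ih _ hlt (isZeroSum_sub hU hS hUi.2.1)
      refine ⟨U ::ₘ Z, ?_, ?_⟩
      · simpa using ⟨hUi, hZ⟩
      · rw [Multiset.sum_cons, hZS, add_tsub_cancel_of_le hU]

theorem IsFactorization.add {S T : IndexedSeq G} {Z W : Multiset (IndexedSeq G)}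
    (hZ : S.IsFactorization Z) (hW : T.IsFactorization W) : (S + T).IsFactorization (Z + W) :=
  ⟨fun U hU => (Multiset.mem_add.1 hU).elim (hZ.1 U) (hW.1 U), by
    rw [Multiset.sum_add, hZ.2, hW.2]⟩

theorem IsFactorization.le {S U : IndexedSeq G} {Z : Multiset (IndexedSeq G)}
    (hZ : S.IsFactorization Z) (hU : U ∈ Z) : U ≤ S :=
  hZ.2 ▸ Multiset.le_sum_of_mem hU

theorem sigma_filter_sum_eq_zero (P : {g : G // g ≠ 0} × ℕ → Prop) [DecidablePred P]
    (Z : Multiset (IndexedSeq G)) (h : ∀ U ∈ Z, sigma (Multiset.filter P U) = 0) :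
    sigma (Multiset.filter P Z.sum) = 0 := by
  induction Z using Multiset.induction_on with
  | empty => simp [sigma]
  | cons U Z ih =>
    rw [Multiset.sum_cons, Multiset.filter_add, sigma_add, h U (Multiset.mem_cons_self _ _),
      ih fun V hV => h V (Multiset.mem_cons_of_mem hV), add_zero]

/-- Factorizations of a zero-sum subsequence and of its complement combine to the unique
factorization. So every factor of `A` lies either in `B` or in the complement of `B`, and `A ∩ B`
is the product of the former. -/
theorem IsUFIS.uniqueZeroSums [DecidableEq G] {S : IndexedSeq G} (hS : S.IsUFIS) :
    UniqueZeroSums (⟨S, hS.1⟩ : Finset ({g : G // g ≠ 0} × ℕ)) fun x => (x.1 : G) := by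
  obtain ⟨hnd, hz, Z, -, huniq⟩ := hS
  have key : ∀ A : IndexedSeq G, A ≤ S → A.IsZeroSum →
      ∃ Y W, A.IsFactorization Y ∧ (S - A).IsFactorization W ∧ Y + W = Z := by
    intro A hA hA0
    obtain ⟨Y, hY⟩ := exists_isFactorization hA0
    obtain ⟨W, hW⟩ := exists_isFactorization (isZeroSum_sub hA hz hA0)
    refine ⟨Y, W, hY, hW, huniq _ ?_⟩
    have := hY.add hW
    rwa [add_tsub_cancel_of_le hA] at this
  intro A hA B hB hA0 hB0
  obtain ⟨Y, W, hY, -, hYW⟩ := key A.val (Finset.val_le_iff.2 hA) hA0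
  obtain ⟨Y', W', hY', hW', hYW'⟩ := key B.val (Finset.val_le_iff.2 hB) hB0
  have h1 := sigma_filter_sum_eq_zero (· ∈ B) Y fun U hU => by
    have hU' : U ∈ Y' + W' := hYW' ▸ hYW ▸ Multiset.mem_add.2 (Or.inl hU)
    rcases Multiset.mem_add.1 hU' with h | h
    · have h2 : Multiset.filter (· ∈ B) U = U :=
        Multiset.filter_eq_self.2 fun x hx => Multiset.mem_of_le (hY'.le h) hx
      rw [h2]
      exact (hY.1 U hU).2.1
    · have h2 : Multiset.filter (· ∈ B) U = 0 := Multiset.filter_eq_nil.2 fun x hx hxB => by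
        have h3 := Multiset.mem_of_le (hW'.le h) hx
        rw [Multiset.mem_sub_of_nodup hnd] at h3
        exact h3.2 hxB
      rw [h2]
      rfl
  rw [hY.2] at h1
  rw [← Finset.filter_mem_eq_inter]
  exact h1

/-- Two irreducible subsequences with a common term coincide, since their intersection is
zero-sum. So the factors are all the irreducible subsequences, each occurring once. -/
theorem isUFIS_of_uniqueZeroSums [DecidableEq G] {F : Finset ({g : G // g ≠ 0} × ℕ)}
    (hF : UniqueZeroSums F fun x => (x.1 : G)) (h0 : ∑ x ∈ F, (x.1 : G) = 0) :
    IsUFIS F.val := by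
  have hmem : ∀ Z, IsFactorization F.val Z → ∀ U, U ∈ Z ↔ U.IsIrreducible ∧ U ≤ F.val := by
    intro Z hZ U
    refine ⟨fun hU => ⟨hZ.1 U hU, hZ.le hU⟩, fun ⟨hU, hUF⟩ => ?_⟩
    obtain ⟨x, hx⟩ := Multiset.exists_mem_of_ne_zero hU.1
    obtain ⟨V, hV, hxV⟩ : ∃ V ∈ Z, x ∈ V := by
      have h1 := Multiset.mem_of_le hUF hx
      rw [← hZ.2] at h1
      exact Multiset.mem_join.1 h1
    have hVF := hZ.le hV
    have h1 := hF ⟨U, Multiset.nodup_of_le hUF F.nodup⟩ (Finset.val_le_iff.1 hUF)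
      ⟨V, Multiset.nodup_of_le hVF F.nodup⟩ (Finset.val_le_iff.1 hVF) hU.2.1 (hZ.1 V hV).2.1
    rw [← sigma_val, Finset.inter_val] at h1
    have hne : U ∩ V ≠ 0 := fun h => by
      have : x ∈ U ∩ V := Multiset.mem_inter.2 ⟨hx, hxV⟩
      rw [h] at this
      exact Multiset.notMem_zero x this
    have h2 := hU.2.2 (U ∩ V) Multiset.inter_le_left hne h1
    have h3 := (hZ.1 V hV).2.2 (U ∩ V) Multiset.inter_le_right hne h1
    rw [← h2, h3]
    exact hV
  have hnd : ∀ Z, IsFactorization F.val Z → Z.Nodup := by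
    intro Z hZ
    rw [Multiset.nodup_iff_ne_cons_cons]
    rintro U W rfl
    obtain ⟨x, hx⟩ := Multiset.exists_mem_of_ne_zero (hZ.1 U (Multiset.mem_cons_self _ _)).1
    have h1 := F.nodup
    rw [← hZ.2, Multiset.sum_cons, Multiset.sum_cons] at h1
    exact Multiset.disjoint_left.1 (Multiset.nodup_add.1 h1).2.2 hx
      (Multiset.mem_add.2 (Or.inl hx))
  refine ⟨F.nodup, h0, ?_⟩
  obtain ⟨Z, hZ⟩ := exists_isFactorization (S := F.val) h0
  refine ⟨Z, hZ, fun W hW => ?_⟩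
  exact (Multiset.Nodup.ext (hnd W hW) (hnd Z hZ)).2 fun U => by rw [hmem W hW, hmem Z hZ]

end IndexedSeq

/-! ### The lower bound -/

theorem UniqueZeroSums.map {ι κ G : Type*} [DecidableEq ι] [DecidableEq κ] [AddCommGroup G]
    {s : Finset ι} {g : κ → G} (e : ι ↪ κ) (h : UniqueZeroSums s fun i => g (e i)) :
    UniqueZeroSums (s.map e) g := by
  intro A hA B hB hA0 hB0
  obtain ⟨A', hA', rfl⟩ := Finset.subset_map_iff.1 hA
  obtain ⟨B', hB', rfl⟩ := Finset.subset_map_iff.1 hB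
  rw [← Finset.map_inter, Finset.sum_map]
  rw [Finset.sum_map] at hA0 hB0
  exact h A' hA' B' hB' hA0 hB0

/-- Some zero-sum family of nonzero elements of `H` with unique zero sums has cross number `x`. -/
def Attains {G : Type*} [AddCommGroup G] (H : AddSubgroup G) (x : ℚ) : Prop :=
  ∃ (ι : Type) (_ : Fintype ι) (_ : DecidableEq ι) (g : ι → G),
    UniqueZeroSums Finset.univ g ∧ ∑ i, g i = 0 ∧ (∀ i, g i ∈ H ∧ g i ≠ 0) ∧
      cross Finset.univ g = x

section

variable {G : Type*} [AddCommGroup G] {H K : AddSubgroup G} {x : ℚ}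

theorem attains_zero (H : AddSubgroup G) : Attains H 0 :=
  ⟨Empty, inferInstance, inferInstance, Empty.elim,
    fun A _ B _ _ _ => Finset.sum_eq_zero fun i => i.elim, by simp, by simp,
    by simp [cross]⟩

theorem Attains.exists_isUFIS (h : Attains H x) :
    ∃ S : IndexedSeq G, S.IsUFIS ∧ S.crossNumber = x := by
  classical
  obtain ⟨ι, _, _, g, hu, h0, hne, hx⟩ := h
  let e : ι ↪ {g : G // g ≠ 0} × ℕ :=
    ⟨fun i => (⟨g i, (hne i).2⟩, (Fintype.equivFin ι i : ℕ)), fun i j hij =>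
      (Fintype.equivFin ι).injective (Fin.ext (congrArg Prod.snd hij))⟩
  refine ⟨(Finset.univ.map e).val, ?_, ?_⟩
  · refine IndexedSeq.isUFIS_of_uniqueZeroSums (UniqueZeroSums.map e ?_) ?_
    · exact hu
    · rw [Finset.sum_map]
      exact h0
  · rw [← hx]
    change ∑ y ∈ Finset.univ.map e, 1 / (addOrderOf (y.1 : G) : ℚ) = _
    rw [Finset.sum_map]
    rfl

/-- Adding a block of `p` terms which are congruent to `u` modulo `H`, where no multiple `t • u`
with `0 < t < p` lies in `H`: a zero sum involves all or none of the new terms. -/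
theorem Attains.add_block (h : Attains H x) (hHK : H ≤ K) {p : ℕ} {u : G}
    (hu : ∀ t : ℕ, 0 < t → t < p → t • u ∉ H) (hp : 2 ≤ p) {b : Fin p → G}
    (hb : ∀ i, b i - u ∈ H) (hbK : ∀ i, b i ∈ K) (hb0 : ∑ i, b i = 0) :
    Attains K (x + cross Finset.univ b) := by
  obtain ⟨ι, _, _, g, huz, h0, hne, rfl⟩ := h
  have hblock : ∀ B : Finset (Fin p), ∑ i ∈ B, b i ∈ H → B = ∅ ∨ B = Finset.univ := by
    intro B hB
    have h1 : B.card • u ∈ H := by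
      have h2 : ∑ i ∈ B, (b i - u) ∈ H := AddSubgroup.sum_mem _ fun i _ => hb i
      rw [Finset.sum_sub_distrib, Finset.sum_const] at h2
      simpa using H.sub_mem hB h2
    have h3 := Finset.card_le_univ B
    rw [Fintype.card_fin] at h3
    rcases Nat.eq_zero_or_pos B.card with h4 | h4
    · exact Or.inl (Finset.card_eq_zero.1 h4)
    · refine Or.inr ((Finset.card_eq_iff_eq_univ B).1 ?_)
      rw [Fintype.card_fin]
      by_contra hne
      exact hu _ h4 (lt_of_le_of_ne h3 hne) h1
  have hsplit : ∀ A : Finset (ι ⊕ Fin p), ∑ i ∈ A, Sum.elim g b i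
      = ∑ i ∈ A.toLeft, g i + ∑ i ∈ A.toRight, b i := fun A => by
    rw [← Finset.toLeft_disjSum_toRight (u := A), Finset.sum_disjSum]
    simp
  have key : ∀ A : Finset (ι ⊕ Fin p), ∑ i ∈ A, Sum.elim g b i = 0 →
      ∑ i ∈ A.toLeft, g i = 0 ∧ (A.toRight = ∅ ∨ A.toRight = Finset.univ) := by
    intro A hA
    rw [hsplit] at hA
    have h1 := hblock A.toRight (by
      rw [eq_neg_of_add_eq_zero_right hA]
      exact H.neg_mem (AddSubgroup.sum_mem _ fun i _ => (hne i).1))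
    refine ⟨?_, h1⟩
    rcases h1 with h1 | h1
    · simpa [h1] using hA
    · simpa [h1, hb0] using hA
  refine ⟨ι ⊕ Fin p, inferInstance, inferInstance, Sum.elim g b, ?_, ?_, ?_, ?_⟩
  · intro A _ B _ hA hB
    obtain ⟨hA1, hA2⟩ := key A hA
    obtain ⟨hB1, hB2⟩ := key B hB
    rw [hsplit, Finset.toLeft_inter, Finset.toRight_inter,
      huz _ (Finset.subset_univ _) _ (Finset.subset_univ _) hA1 hB1, zero_add]
    rcases hA2 with hA2 | hA2 <;> rcases hB2 with hB2 | hB2 <;> simp [hA2, hB2, hb0]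
  · simp [h0, hb0]
  · rintro (i | i)
    · exact ⟨hHK (hne i).1, (hne i).2⟩
    · refine ⟨hbK i, fun h => hu 1 one_pos hp ?_⟩
      have h1 := H.neg_mem (hb i)
      simp only [Sum.elim_inr] at h
      simpa [h] using h1
  · simp [cross]

/-- A block consisting of `p - 1` copies of an element of order `p ^ (j + 1)` and one multiple of
it contributes `1 / p ^ j`. -/
theorem Attains.add_prime_power_block [Finite G] (h : Attains H x) (hHK : H ≤ K) {p j : ℕ}
    (hp : p.Prime) {u : G} (hord : addOrderOf u = p ^ (j + 1)) (huK : u ∈ K) (hpu : p • u ∈ H)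
    (hu : ∀ t : ℕ, 0 < t → t < p → t • u ∉ H) : Attains K (x + 1 / (p : ℚ) ^ j) := by
  obtain ⟨r, rfl⟩ : ∃ r, p = r + 1 := ⟨p - 1, by have := hp.pos; omega⟩
  have hord' : addOrderOf (-(r • u)) = (r + 1) ^ (j + 1) := by
    rw [addOrderOf_neg, addOrderOf_nsmul, hord, Nat.Coprime.gcd_eq_one, Nat.div_one]
    exact Nat.Coprime.pow_left _ (by simp)
  have hb := h.add_block hHK hu hp.two_le (b := Fin.cons (-(r • u)) fun _ => u) (fun i => by
      refine Fin.cases ?_ (fun i => ?_) i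
      · rw [Fin.cons_zero, show -(r • u) - u = -((r + 1) • u) by rw [succ_nsmul]; abel]
        exact H.neg_mem hpu
      · simp) (fun i => by
      refine Fin.cases ?_ (fun i => ?_) i
      · rw [Fin.cons_zero]
        exact K.neg_mem (K.nsmul_mem huK _)
      · simpa using huK) (by simp [Fin.sum_univ_succ])
  convert hb using 2
  have hp0 : ((r : ℚ) + 1) ≠ 0 := by exact_mod_cast Nat.succ_ne_zero r
  simp only [cross, Fin.sum_univ_succ, Fin.cons_zero, Fin.cons_succ, hord, hord']
  simp only [Finset.sum_const, Finset.card_univ, Fintype.card_fin, nsmul_eq_mul]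
  push_cast
  field_simp
  ring

end

section

variable {n : ℕ} [NeZero n]

theorem sum_geomSum_prime_mul {p m : ℕ} (hp : p.Prime) (hm : m ≠ 0) {S : Finset ℕ} (hpS : p ∈ S) :
    ∑ r ∈ S, geomSum r ((p * m).factorization r)
      = ∑ r ∈ S, geomSum r (m.factorization r) + 1 / (p : ℚ) ^ m.factorization p := by
  have h : ∀ r ∈ S, geomSum r ((p * m).factorization r)
      = geomSum r (m.factorization r) + if r = p then 1 / (p : ℚ) ^ m.factorization p else 0 := by
    intro r _
    rw [Nat.factorization_mul hp.ne_zero hm, hp.factorization, Finsupp.add_apply]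
    by_cases hr : r = p
    · subst hr
      rw [Finsupp.single_eq_same, if_pos rfl, add_comm 1, geomSum, Finset.sum_range_succ]
      rfl
    · rw [Finsupp.single_eq_of_ne hr, if_neg hr, zero_add, add_zero]
  rw [Finset.sum_congr rfl h, Finset.sum_add_distrib, Finset.sum_ite_eq' S p, if_pos hpS]

/-- Starting from a family in a complement of `ZMod n`, blocks are added one by one, according to
a chain of subgroups of prime index. -/
theorem Attains.extend {G : Type*} [AddCommGroup G] [Finite G] (φ : G →+ ZMod n)
    (σ : ZMod n →+ G) (hσ : ∀ y, φ (σ y) = y) {x : ℚ} (h : Attains φ.ker x) {m : ℕ} (hmn : m ∣ n) :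
    Attains (((nsmulAddMonoidHom m).comp φ).ker)
      (x + ∑ r ∈ n.primeFactors, geomSum r (m.factorization r)) := by
  induction m using induction_on_primes with
  | zero => exact absurd (zero_dvd_iff.1 hmn) (NeZero.ne n)
  | one =>
    have h1 : (nsmulAddMonoidHom 1).comp φ = φ := by
      ext z
      simp
    rw [h1]
    simpa [geomSum_zero] using h
  | prime_mul p m hp ih =>
    have hn0 : n ≠ 0 := NeZero.ne n
    have hm0 : m ≠ 0 := by
      rintro rfl
      exact hn0 (by simpa using hmn)
    have hpn : p ∈ n.primeFactors :=
      Nat.mem_primeFactors.2 ⟨hp, (Dvd.intro _ rfl).trans hmn, hn0⟩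
    rw [sum_geomSum_prime_mul hp hm0 hpn, ← add_assoc]
    set j := m.factorization p
    have hjm : p ^ (j + 1) ∣ p * m := by
      rw [pow_succ']
      exact mul_dvd_mul_left p (Nat.ordProj_dvd m p)
    obtain ⟨c, hc⟩ := hjm.trans hmn
    have hc0 : 0 < c := Nat.pos_of_ne_zero (by rintro rfl; exact hn0 (by simpa using hc))
    have hmem : ∀ k t : ℕ, t • σ (c : ZMod n) ∈ ((nsmulAddMonoidHom k).comp φ).ker ↔
        p ^ (j + 1) ∣ k * t := by
      intro k t
      rw [AddMonoidHom.mem_ker, AddMonoidHom.comp_apply, map_nsmul, hσ]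
      change k • t • (c : ZMod n) = 0 ↔ _
      rw [smul_smul, nsmul_eq_mul, ← Nat.cast_mul, ZMod.natCast_eq_zero_iff]
      conv_lhs => rw [hc]
      exact Nat.mul_dvd_mul_iff_right hc0
    have hmem1 : ∀ k : ℕ, σ (c : ZMod n) ∈ ((nsmulAddMonoidHom k).comp φ).ker ↔
        p ^ (j + 1) ∣ k := fun k => by simpa using hmem k 1
    refine (ih ((Dvd.intro_left _ rfl).trans hmn)).add_prime_power_block (u := σ (c : ZMod n))
      ?_ hp ?_ ((hmem1 _).2 hjm) ((hmem _ _).2 (by rwa [mul_comm])) fun t ht htp htm => ?_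
    · intro z hz
      change (p * m) • φ z = 0
      rw [mul_nsmul', show m • φ z = 0 from hz, smul_zero]
    · rw [addOrderOf_injective σ (Function.LeftInverse.injective hσ), ZMod.addOrderOf_coe _ hn0,
        Nat.gcd_eq_right (Dvd.intro_left _ hc.symm)]
      exact Nat.div_eq_of_eq_mul_left hc0 hc
    · rw [hmem] at htm
      have h1 : Nat.Coprime (p ^ (j + 1)) t :=
        Nat.Coprime.pow_left _ ((Nat.Prime.coprime_iff_not_dvd hp).2 fun h =>
          absurd (Nat.le_of_dvd ht h) (not_le.2 htp))
      exact Nat.pow_succ_factorization_not_dvd hm0 hp (h1.dvd_of_dvd_mul_right htm)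

theorem Attains.extend_top {G : Type*} [AddCommGroup G] [Finite G] (φ : G →+ ZMod n)
    (σ : ZMod n →+ G) (hσ : ∀ y, φ (σ y) = y) {x : ℚ} (h : Attains φ.ker x) :
    Attains (⊤ : AddSubgroup G) (x + ∑ r ∈ n.primeFactors, geomSum r (n.factorization r)) := by
  have h1 : ((nsmulAddMonoidHom n).comp φ).ker = ⊤ := by
    ext z
    simp [AddMonoidHom.mem_ker]
  exact h1 ▸ h.extend φ σ hσ dvd_rfl

theorem attains_zmod :
    Attains (⊤ : AddSubgroup (ZMod n)) (∑ r ∈ n.primeFactors, geomSum r (n.factorization r)) := by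
  simpa using (attains_zero _).extend_top (AddMonoidHom.id (ZMod n)) (AddMonoidHom.id _)
    fun _ => rfl

theorem attains_prod {q : ℕ} [NeZero q] (hq : q.Prime) :
    Attains (⊤ : AddSubgroup (ZMod n × ZMod q))
      (1 + ∑ r ∈ n.primeFactors, geomSum r (n.factorization r)) := by
  refine Attains.extend_top (AddMonoidHom.fst _ _) (AddMonoidHom.inl _ _) (fun _ => rfl) ?_
  have hmem : ∀ t : ℕ, t • ((0, 1) : ZMod n × ZMod q) = 0 ↔ q ∣ t := fun t => by
    simp [Prod.ext_iff, ZMod.natCast_eq_zero_iff]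
  have hord : addOrderOf ((0, 1) : ZMod n × ZMod q) = q := by
    have : Fact q.Prime := ⟨hq⟩
    refine addOrderOf_eq_prime ((hmem q).2 dvd_rfl) fun h => ?_
    simp at h
  have h1 := (attains_zero (⊥ : AddSubgroup (ZMod n × ZMod q))).add_block
    (K := (AddMonoidHom.fst (ZMod n) (ZMod q)).ker) bot_le (p := q) (u := (0, 1))
    (fun t ht htq h => absurd (Nat.le_of_dvd ht ((hmem t).1 h)) (not_le.2 htq)) hq.two_le
    (b := fun _ => (0, 1)) (by simp) (fun _ => rfl) (by simp)
  convert h1 using 1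
  have hq0 : (q : ℚ) ≠ 0 := by exact_mod_cast hq.ne_zero
  simp [cross, hord, hq0]

/-! ### The value of `K₁*` -/

/-- The primary decomposition of `ZMod n` given by the Chinese remainder theorem. -/
noncomputable def zmodDecomposition (n : ℕ) [NeZero n] : PrimaryDecomposition (ZMod n) where
  ι := n.primeFactors
  p r := r
  prime r := Nat.prime_of_mem_primeFactors r.2
  e r := n.factorization r
  equiv := (ZMod.equivPi n (NeZero.ne n)).toAddEquiv.trans (DirectSum.addEquivProd _).symm

/-- A decomposition of `G` gives one of `G × ZMod q`, with an additional summand. -/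
noncomputable def PrimaryDecomposition.prodZMod {G : Type*} [AddCommGroup G]
    (D : PrimaryDecomposition G) {q : ℕ} (hq : q.Prime) : PrimaryDecomposition (G × ZMod q) where
  ι := Option D.ι
  p o := o.elim q D.p
  prime o := match o with
    | none => hq
    | some i => D.prime i
  e o := o.elim 1 D.e
  equiv := (AddEquiv.prodComm.trans
    ((ZMod.ringEquivCongr (pow_one q).symm).toAddEquiv.prodCongr D.equiv)).trans
      (DirectSum.addEquivProdDirectSum
        (α := fun o : Option D.ι => ZMod (o.elim q D.p ^ o.elim 1 D.e))).symm

theorem kOneSum_zmodDecomposition : (zmodDecomposition n).kOneSum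
    = ∑ r ∈ n.primeFactors, geomSum r (n.factorization r) := by
  change ∑ r : n.primeFactors, kOneTerm r (n.factorization r) = _
  rw [← Finset.sum_coe_sort n.primeFactors]
  exact Finset.sum_congr rfl fun r _ =>
    kOneTerm_eq_geomSum (Nat.prime_of_mem_primeFactors r.2) _

theorem kOneStar_zmod :
    kOneStar (ZMod n) = ∑ r ∈ n.primeFactors, geomSum r (n.factorization r) := by
  rw [kOneStar_eq (zmodDecomposition n), kOneSum_zmodDecomposition]

theorem kOneStar_prod {q : ℕ} [NeZero q] (hq : q.Prime) :
    kOneStar (ZMod n × ZMod q) = 1 + ∑ r ∈ n.primeFactors, geomSum r (n.factorization r) := by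
  rw [kOneStar_eq ((zmodDecomposition n).prodZMod hq), ← kOneSum_zmodDecomposition]
  change ∑ o : Option (zmodDecomposition n).ι, kOneTerm (o.elim q (zmodDecomposition n).p)
    (o.elim 1 (zmodDecomposition n).e) = _
  rw [Fintype.sum_option]
  congr 1
  change kOneTerm q 1 = 1
  rw [kOneTerm_eq_geomSum hq]
  simp [geomSum]

theorem isKOne_of_attains {G : Type} [AddCommGroup G] {e : ℕ} {x : ℚ}
    (hA : Attains (⊤ : AddSubgroup G) x) (hB : CrossBound (⊤ : AddSubgroup G) e x)
    (he : ∀ z : G, e • z = 0) : IsKOne G x := by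
  classical
  refine ⟨hA.exists_isUFIS, ?_⟩
  rintro _ ⟨S, hS, rfl⟩
  exact hB _ _ _ hS.uniqueZeroSums (fun _ _ => ⟨trivial, he _⟩) fun y _ => y.1.2

end

theorem mainTheorem7 (n q : ℕ) [NeZero n] [NeZero q] (hn : TwoWide n)
    (hq : IsLargestPrimeFactor n q ∨ IsSecondLargestPrimeFactor n q) :
    IsKOne (ZMod n) (kOneStar (ZMod n)) ∧
      IsKOne (ZMod n × ZMod q) (kOneStar (ZMod n × ZMod q)) := by
  obtain ⟨hqp, hqn⟩ : q.Prime ∧ q ∣ n := by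
    rcases hq with hq | ⟨r, -, hq⟩
    · exact hq.1
    · exact ⟨hq.1.1, hq.1.2.1⟩
  rw [kOneStar_zmod, kOneStar_prod hqp]
  refine ⟨isKOne_of_attains attains_zmod hn.crossBound_zmod (by simp),
    isKOne_of_attains (attains_prod hqp) (hn.crossBound_prod hq) ?_⟩
  rintro ⟨a, b⟩
  have hb : n • b = 0 := by
    obtain ⟨k, rfl⟩ := hqn
    rw [mul_nsmul, show q • b = 0 by simp, smul_zero]
  exact Prod.ext (by simp) hb
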